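/- All graphs are simple and undirected. The rank $\operatorname{rank}(G)$ of a finitely generated group $G$ is the smallest cardinality of a generating set. A generating set $S$ of $G$ is always assumed not to contain the identity, and the Cayley graph $\mathrm{Cay}(G,S)$ has vertex set $G$, with $g$ and $h$ adjacent if and only if $g^{-1}h\in S\cup S^{-1}$. It is a graphical regular representation (GRR) of $G$ if its automorphisms are exactly the left multiplications by elements of $G$. A group is generalized dicyclic if it is non-abelian and has an abelian normal subgroup $A$ of index $2$ and an element $x\notin A$ of order $4$ such that $xax^{-1}=a^{-1}$ for every $a\in A$. An element of infinite order is regarded as having order at least $n$ for every $n$. Put $F(n)=2(2n^2+3n-2)^2(2n^2+4n-1)$. Theorem. Let $G$ be a finitely generated group that is neither abelian nor generalized dicyclic. 1. If $G$ has an element of order at least $(2\operatorname{rank}(G))^{36}$, then $G$ has a locally finite GRR. 2. If $G$ has an element of order at least $F(32\operatorname{rank}(G)^6)$, then $G$ has a GRR of valency at most $32\operatorname{rank}(G)^6$. 3. If $G$ has no elements of order $4$ or no non-trivial characteristic abelian subgroups, and $G$ has an element of order at least $F(18\operatorname{rank}(G)^2+84\operatorname{rank}(G)-4)$, then $G$ has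 a GRR of valency at most $18\operatorname{rank}(G)^2+84\operatorname{rank}(G)$. 4. Suppose that $G$ has elements of arbitrarily large order, that is, for every $n$ it has an element of order at least $n$. Then for every finite generating set $S$ of $G$ there is a finite symmetric generating set $T\supseteq S$ such that $\mathrm{Cay}(G,T)$ is a GRR of $G$ and $|T|\le 32|S|^6$. If moreover $G$ has no elements of order $4$ or no non-trivial characteristic abelian subgroups, then $T$ can be chosen with $|T|\le 18|S|^2+84|S|$. -/

import Mathlib

/-- `G` is a generalized dicyclic group: it is not abelian, and it has an abelian normal subgroup
`A` of index `2` together with an element `x ∉ A` of order `4` such that `x a x⁻¹ = a⁻¹` for every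
`a ∈ A`. -/
def IsGeneralizedDicyclic (G : Type*) [Group G] : Prop :=
  (¬ ∀ a b : G, a * b = b * a) ∧
    ∃ A : Subgroup G, A.Normal ∧ A.index = 2 ∧ (∀ a ∈ A, ∀ b ∈ A, a * b = b * a) ∧
      ∃ x : G, x ∉ A ∧ orderOf x = 4 ∧ ∀ a ∈ A, x * a * x⁻¹ = a⁻¹

/-- The order of `g` is at least `n`. Elements of infinite order (for which `orderOf g = 0`) have
order at least `n` for every `n`. -/
def OrderAtLeast {G : Type*} [Group G] (g : G) (n : ℤ) : Prop :=
  ¬ IsOfFinOrder g ∨ n ≤ (orderOf g : ℤ)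

/-- `S` defines a Cayley graph of `G`: it generates `G` and does not contain the identity. The
graph itself is `SimpleGraph.mulCayley S`, in which `g` and `h` are adjacent if and only if
`g⁻¹ * h ∈ S ∪ S⁻¹`, see `mulCayley_adj_iff_of_isCayleySet`. -/
def IsCayleySet {G : Type*} [Group G] (S : Set G) : Prop :=
  Subgroup.closure S = ⊤ ∧ (1 : G) ∉ S

theorem mulCayley_adj_iff_of_isCayleySet {G : Type*} [Group G] {S : Set G} (hS : IsCayleySet S)
    (g h : G) : (SimpleGraph.mulCayley S).Adj g h ↔ g⁻¹ * h ∈ S ∨ (g⁻¹ * h)⁻¹ ∈ S := by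
  rw [SimpleGraph.mulCayley_adj']
  constructor
  · rintro ⟨-, s, hs, rfl | rfl⟩
    · left; simpa using hs
    · right; simpa using hs
  · intro H
    refine ⟨?_, ?_⟩
    · rintro rfl
      rcases H with H | H <;> exact hS.2 (by simpa using H)
    · rcases H with H | H
      · exact ⟨_, H, Or.inl (by group)⟩
      · exact ⟨_, H, Or.inr (by group)⟩

/-- The Cayley graph of `G` with respect to `S` is a graphical regular representation (GRR): its
automorphisms are exactly the left multiplications by elements of `G`. -/
def IsGRR {G : Type*} [Group G] (S : Set G) : Prop :=
  IsCayleySet S ∧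
    ∀ φ : Equiv.Perm G,
      (∀ x y : G, (SimpleGraph.mulCayley S).Adj (φ x) (φ y) ↔ (SimpleGraph.mulCayley S).Adj x y) ↔
        ∃ g : G, φ = Equiv.mulLeft g

/-- Every vertex has finitely many neighbours. -/
def GraphLocallyFinite {V : Type*} (Γ : SimpleGraph V) : Prop :=
  ∀ v : V, (Γ.neighborSet v).Finite

/-- Every vertex has exactly `d` neighbours; in particular the graph is locally finite. -/
def HasValency {V : Type*} (Γ : SimpleGraph V) (d : ℕ) : Prop :=
  ∀ v : V, (Γ.neighborSet v).encard = d

/-- `G` has no element of order `4`, or its only abelian characteristic subgroup is trivial. -/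
def NoOrderFourOrNoCharAbelian (G : Type*) [Group G] : Prop :=
  (∀ g : G, orderOf g ≠ 4) ∨
    ∀ H : Subgroup G, H.Characteristic → (∀ a ∈ H, ∀ b ∈ H, a * b = b * a) → H = ⊥

/-- The polynomial `F(n) = 2 (2n² + 3n - 2)² (2n² + 4n - 1)`. -/
def orderBound (n : ℤ) : ℤ :=
  2 * (2 * n ^ 2 + 3 * n - 2) ^ 2 * (2 * n ^ 2 + 4 * n - 1)

/-! The argument separates an algebraic problem from a combinatorial one.

Algebra: colour an edge `(g, g * s)` by `s` up to inversion. A map that preserves the colours and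
orientations of a generating set is a left translation, so it is enough to find a few colours whose
preservation forces the orientations. Comparing the path `s`, `t` with the single edge `s * t` shows
that an edge coloured by `s` can be reversed only if every `t` satisfies one of the relations in
`Reversible s`. A non-reversible `s` therefore costs three colours. Reversible elements are very
constrained: non-central ones have exponent 4 and central square. If seven colours never suffice for
`s`, these constraints spread over the whole group and make it generalized dicyclic
(`forced_seven`).

Combinatorics: automorphisms preserve the number of triangles on an edge. The generating set is
enlarged until each needed colour has its own triangle count, up to inversion, above that of every
added element; automorphisms then preserve these colours. To raise the count of `c`, one adds `u`,
`c * u` and their inverses, with `u` a power of the element `g` of large order. A generic exponent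
avoids all accidental triangles. The unavoidable ones affect only `c` and, when `c` inverts a power
of `g`, its square, together with their inverses; the order in which colours are treated takes care
of the squares. -/

set_option linter.unusedSimpArgs false

/-- The map `φ` sends every edge coloured by `s` to an edge coloured by `s`, up to orientation. -/
def PreservesColour {G : Type*} [Group G] (φ : G → G) (s : G) : Prop :=
  ∀ g, φ (g * s) = φ g * s ∨ φ (g * s) = φ g * s⁻¹

/-- The map `φ` preserves every edge coloured by `s`, together with its orientation. -/
def PreservesEdges {G : Type*} [Group G] (φ : G → G) (s : G) : Prop :=
  ∀ g, φ (g * s) = φ g * s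

/-- There is a set `W ∋ s` of at most `k` colours such that every map preserving the colours in `W`
preserves the orientation of the edges coloured by `s`. -/
def Forced {G : Type*} [Group G] (k : ℕ) (s : G) : Prop :=
  ∃ W : Finset G, W.card ≤ k ∧ s ∈ W ∧
    ∀ φ : G → G, (∀ w ∈ W, PreservesColour φ w) → PreservesEdges φ s

/-- No element `t` obstructs the existence of a colour preserving map reversing an edge coloured
by `s`. -/
def Reversible {G : Type*} [Group G] (s : G) : Prop :=
  ∀ t : G, s * t = t * s ∨ s⁻¹ * t * s = t⁻¹ ∨ (s ^ 2 * t ^ 2 = 1 ∧ t ^ 2 = s ^ 2)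

/-! ### Colour-preserving maps and forced orientations -/

section Colour

variable {G : Type*} [Group G] {φ : G → G} {s t : G}

theorem PreservesColour.inv (h : PreservesColour φ s) : PreservesColour φ s⁻¹ := by
  intro g
  rcases h (g * s⁻¹) with h | h <;> rw [inv_mul_cancel_right] at h
  · left; rw [h]; group
  · right; rw [h]; group

theorem PreservesEdges.of_inv (h : PreservesEdges φ s⁻¹) : PreservesEdges φ s := by
  intro g
  have h := h (g * s)
  rw [mul_inv_cancel_right] at h
  rw [h]; group

/-- If a colour preserving map reverses the edge `(g, g * s)`, there are three possibilities for
its behaviour at `g * (s * t)`. -/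
theorem PreservesColour.reversed_cases (hs : PreservesColour φ s) (ht : PreservesColour φ t)
    (hst : PreservesColour φ (s * t)) {g : G} (hg : φ (g * s) ≠ φ g * s) :
    φ (g * s * t) = φ (g * s) * t ∧ φ (g * (s * t)) = φ g * (s * t)⁻¹ ∧ s⁻¹ * t * s = t⁻¹ ∨
    φ (g * s * t) = φ (g * s) * t⁻¹ ∧ s ^ 2 * t ^ 2 = 1 ∨
    φ (g * s * t) = φ (g * s) * t⁻¹ ∧ φ (g * (s * t)) = φ g * (s * t)⁻¹ ∧ s * t = t * s := by
  have h1 : φ (g * s) = φ g * s⁻¹ := (hs g).resolve_left hg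
  have hss : s ≠ s⁻¹ := by
    rintro h; rw [← h] at h1; exact hg h1
  have e : g * s * t = g * (s * t) := mul_assoc _ _ _
  -- The image of `g * s * t` is computed along `s`, `t` and along `s * t`. Of the four sign
  -- patterns, the one with both signs positive gives `s = s⁻¹`; each of the others gives one
  -- relation.
  rcases ht (g * s) with h2 | h2 <;> rcases hst g with h3 | h3
  · rw [e, h3, h1, mul_assoc] at h2
    have := mul_right_cancel (mul_left_cancel h2)
    exact absurd this hss
  · left
    refine ⟨h2, h3, ?_⟩
    rw [e, h3, h1, mul_assoc] at h2
    have := mul_left_cancel h2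
    calc s⁻¹ * t * s = (s * t)⁻¹ * s := by rw [this]
      _ = t⁻¹ := by group
  · right; left
    refine ⟨h2, ?_⟩
    rw [e, h3, h1, mul_assoc] at h2
    have := mul_left_cancel h2
    calc s ^ 2 * t ^ 2 = s * (s * t) * t := by simp only [pow_two, mul_assoc]
      _ = 1 := by rw [this]; group
  · right; right
    refine ⟨h2, h3, ?_⟩
    rw [e, h3, h1, mul_assoc] at h2
    have := mul_left_cancel h2
    have := congrArg (·⁻¹) this
    simpa using this

theorem PreservesColour.preservesEdges (hs : PreservesColour φ s) (ht : PreservesColour φ t)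
    (hst : PreservesColour φ (s * t)) (h1 : s * t ≠ t * s) (h2 : s⁻¹ * t * s ≠ t⁻¹)
    (h3 : s ^ 2 * t ^ 2 ≠ 1) : PreservesEdges φ s := by
  intro g
  by_contra hg
  have := hs.reversed_cases ht hst hg
  tauto

/-- Once `t` keeps its orientation, each case of `reversed_cases` forces `t = t⁻¹`. -/
theorem PreservesColour.preservesEdges_of_commute (hs : PreservesColour φ s)
    (ht : PreservesEdges φ t) (hst : PreservesColour φ (s * t)) (h1 : s * t = t * s)
    (h2 : t ^ 2 ≠ 1) : PreservesEdges φ s := by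
  intro g
  by_contra hg
  have key : t ≠ t⁻¹ := by
    intro h; apply h2; rw [pow_two]; nth_rw 2 [h]; simp
  rcases hs.reversed_cases (fun g => Or.inl (ht g)) hst hg with h | h | h
  · have h3 := h.2.2
    rw [mul_assoc, ← h1, inv_mul_cancel_left] at h3
    exact key h3
  · have h4 := h.1; rw [ht] at h4
    exact key (mul_left_cancel h4)
  · have h4 := h.1; rw [ht] at h4
    exact key (mul_left_cancel h4)

/-- The hypotheses exclude two cases of `reversed_cases`; in the remaining one, orientation of `s *
t` would give `s = s⁻¹`. -/
theorem PreservesColour.preservesEdges_of_mul (hs : PreservesColour φ s)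
    (ht : PreservesColour φ t) (hst : PreservesEdges φ (s * t)) (h1 : s * t ≠ t * s)
    (h2 : s ^ 2 * t ^ 2 ≠ 1) : PreservesEdges φ s := by
  intro g
  by_contra hg
  rcases hs.reversed_cases ht (fun g => Or.inl (hst g)) hg with h | h | h
  · have h4 := h.2.1
    rw [hst] at h4
    have h5 := mul_left_cancel h4
    have h6 : s⁻¹ * t * s = t⁻¹ := h.2.2
    have h7 : φ (g * s) = φ g * s⁻¹ := (hs g).resolve_left hg
    have h8 := h.1
    rw [mul_assoc, hst, h7, mul_assoc] at h8
    have h9 := mul_right_cancel (mul_left_cancel h8)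
    rw [← h9] at h7
    exact hg h7
  · exact h2 h.2
  · exact h1 h.2.2

theorem Forced.mono {k l : ℕ} (h : Forced k s) (hkl : k ≤ l) : Forced l s := by
  obtain ⟨W, h1, h2⟩ := h
  exact ⟨W, h1.trans hkl, h2⟩

theorem forced_one_of_sq_eq_one (h : s ^ 2 = 1) : Forced 1 s := by
  refine ⟨{s}, by simp, by simp, fun φ hφ g => ?_⟩
  have e : s⁻¹ = s := by rw [inv_eq_iff_mul_eq_one, ← pow_two, h]
  rcases hφ s (by simp) g with h | h
  · exact h
  · rwa [e] at h

open Classical in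
-- A witness `t` against reversibility works for `s` unless `s ^ 2 * t ^ 2 = 1`. In that case `t ^ 2
-- ≠ s ^ 2`, and `t` works for `s⁻¹` instead.
theorem forced_three_of_not_reversible (h : ¬ Reversible s) : Forced 3 s := by
  unfold Reversible at h
  push Not at h
  obtain ⟨t, h1, h2, h3⟩ := h
  by_cases h4 : s ^ 2 * t ^ 2 = 1
  · refine ⟨{s, t, s⁻¹ * t}, Finset.card_le_three, by simp, fun φ hφ => ?_⟩
    apply PreservesEdges.of_inv
    apply (hφ s (by simp)).inv.preservesEdges (hφ t (by simp)) (hφ _ (by simp))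
    · intro h; apply h1
      calc s * t = s * (t * s⁻¹) * s := by group
        _ = t * s := by rw [← h]; group
    · intro h; apply h2
      have : t = s⁻¹ * t⁻¹ * s := by rw [← h]; group
      have := congrArg (·⁻¹) this
      rw [this]; group
    · intro h; apply h3 h4
      calc t ^ 2 = s ^ 2 * (s⁻¹ ^ 2 * t ^ 2) := by group
        _ = s ^ 2 := by rw [h, mul_one]
  · refine ⟨{s, t, s * t}, Finset.card_le_three, by simp, fun φ hφ => ?_⟩
    exact (hφ s (by simp)).preservesEdges (hφ t (by simp)) (hφ _ (by simp)) h1 h2 h4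

open Classical in
theorem Forced.of_commute {k : ℕ} (ht : Forced k t) (h1 : s * t = t * s) (h2 : t ^ 2 ≠ 1) :
    Forced (k + 2) s := by
  obtain ⟨W, hW, htW, hφW⟩ := ht
  refine ⟨insert s (insert (s * t) W), ?_, by simp, fun φ hφ => ?_⟩
  · have h1 := Finset.card_insert_le s (insert (s * t) W)
    have h2 := Finset.card_insert_le (s * t) W
    omega
  · refine (hφ s (by simp)).preservesEdges_of_commute (hφW φ fun w hw => hφ w ?_)
      (hφ _ (by simp)) h1 h2
    simp [hw]

open Classical in
theorem Forced.of_mul {k : ℕ} (hst : Forced k (s * t)) (h1 : s * t ≠ t * s)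
    (h2 : s ^ 2 * t ^ 2 ≠ 1) : Forced (k + 2) s := by
  obtain ⟨W, hW, htW, hφW⟩ := hst
  refine ⟨insert s (insert t W), ?_, by simp, fun φ hφ => ?_⟩
  · have h1 := Finset.card_insert_le s (insert t W)
    have h2 := Finset.card_insert_le t W
    omega
  · refine (hφ s (by simp)).preservesEdges_of_mul (hφ t (by simp)) (hφW φ fun w hw => hφ w ?_)
      h1 h2
    simp [hw]

end Colour

/-! ### Structure of reversible elements -/

section GroupTheory

variable {G : Type*} [Group G] {s t c : G}

theorem conj_inv_eq (h : s⁻¹ * t * s = t⁻¹) : s⁻¹ * t⁻¹ * s = t := by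
  have := congrArg (·⁻¹) h
  simpa [mul_assoc] using this

theorem conj_sq_eq (h : s⁻¹ * t * s = t⁻¹) : s⁻¹ * t ^ 2 * s = (t ^ 2)⁻¹ := by
  calc s⁻¹ * t ^ 2 * s = (s⁻¹ * t * s) ^ 2 := by simp [pow_succ, mul_assoc]
    _ = (t ^ 2)⁻¹ := by rw [h]; simp [pow_succ, mul_assoc]

theorem sq_mul_of_conj_eq_inv (h : s⁻¹ * t * s = t⁻¹) : (s * t) ^ 2 = s ^ 2 := by
  calc (s * t) ^ 2 = s * s * (s⁻¹ * t * s) * t := by simp [pow_succ, mul_assoc]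
    _ = s ^ 2 := by rw [h]; simp [pow_succ, mul_assoc]

/-- If each of two elements inverts the other, they have the same square. -/
theorem sq_eq_of_conj_eq_inv (h : s⁻¹ * t * s = t⁻¹) (h' : t⁻¹ * s * t = s⁻¹) :
    t ^ 2 = s ^ 2 := by
  have h1 : t * s = s * t⁻¹ := by rw [← h]; simp [pow_succ, mul_assoc]
  have h2 : t⁻¹ * s = s⁻¹ * t⁻¹ := by rw [← h']; simp [pow_succ, mul_assoc]
  have h3 : t⁻¹ * s = s * t := by
    calc t⁻¹ * s = s * (s⁻¹ * t⁻¹ * s) := by simp [pow_succ, mul_assoc]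
      _ = s * t := by rw [conj_inv_eq h]
  have h4 : s * t = s⁻¹ * t⁻¹ := h3.symm.trans h2
  have h5 : s ^ 2 * t ^ 2 = 1 := by
    calc s ^ 2 * t ^ 2 = s * (s * t) * t := by simp only [pow_two, mul_assoc]
      _ = 1 := by rw [h4]; simp [pow_succ, mul_assoc]
  have h6 := conj_sq_eq h
  have h7 : t ^ 2 = (s ^ 2)⁻¹ := eq_inv_of_mul_eq_one_right h5
  have h8 : s⁻¹ * t ^ 2 * s = t ^ 2 := by rw [h7]; simp [pow_succ, mul_assoc]
  rw [h8] at h6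
  rw [h6, h7, inv_inv]

theorem conj_eq_inv_of_sq_eq (h : (s * t) ^ 2 = s ^ 2) : s⁻¹ * t * s = t⁻¹ := by
  calc s⁻¹ * t * s = s⁻¹ * s⁻¹ * (s * t) ^ 2 * t⁻¹ := by simp [pow_succ, mul_assoc]
    _ = t⁻¹ := by rw [h]; simp [pow_succ, mul_assoc]

theorem Reversible.sq_commute (hs : Reversible s) (t : G) : s ^ 2 * t = t * s ^ 2 := by
  rcases hs t with h | h | ⟨-, h⟩
  · exact (Commute.pow_left (show Commute s t from h) 2)
  · have h1 : t = s⁻¹ * t⁻¹ * s := (conj_inv_eq h).symm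
    have h2 : t * s ^ 2 = s ^ 2 * t := by
      calc t * s ^ 2 = s * (s⁻¹ * t * s) * s := by simp [pow_succ, mul_assoc]
        _ = s ^ 2 * (s⁻¹ * t⁻¹ * s) := by rw [h]; simp [pow_succ, mul_assoc]
        _ = s ^ 2 * t := by rw [← h1]
    exact h2.symm
  · rw [← h]; simp [pow_succ, mul_assoc]

/-- A non-central reversible element has exponent `4`. -/
theorem Reversible.pow_four (hs : Reversible s) (ht : s * t ≠ t * s) : s ^ 4 = 1 := by
  have aux : ∀ u : G, s * u ≠ u * s → (s ^ 2 * u ^ 2 = 1 ∧ u ^ 2 = s ^ 2) → s ^ 4 = 1 := by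
    rintro u - ⟨h1, h2⟩
    rw [h2] at h1
    rw [← h1]; simp [pow_succ, mul_assoc]
  have hst : s * (s * t) ≠ s * t * s := by
    intro h; apply ht
    rw [mul_assoc] at h
    exact mul_left_cancel h
  -- Reversibility is tested against `t` and `s * t`. If `s` inverts both, then `t ^ 2 = s ^ 2`, so
  -- `s` both inverts and centralizes `s ^ 2`.
  rcases hs t with h | h | h
  · exact absurd h ht
  · rcases hs (s * t) with h' | h' | h'
    · exact absurd h' hst
    · have h1 : s⁻¹ * (s * t) * s = s * (s⁻¹ * t * s) := by simp [pow_succ, mul_assoc]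
      rw [h1, h] at h'
      have h2 : t ^ 2 = s ^ 2 := by
        have h3 : s * t⁻¹ * (s * t) = 1 := by rw [h']; simp [pow_succ, mul_assoc]
        have h4 : s * t⁻¹ = t * s := by rw [← h]; simp [pow_succ, mul_assoc]
        rw [h4] at h3
        calc t ^ 2 = t * s * (s * t) * (t⁻¹ * s⁻¹ * s⁻¹ * t) := by simp [pow_succ, mul_assoc]
          _ = t⁻¹ * (s ^ 2)⁻¹ * t := by rw [h3]; simp [pow_succ, mul_assoc]
          _ = s ^ 2 := ?_
        have h5 : s ^ 2 * t = t * s ^ 2 := hs.sq_commute t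
        have h6 : t ^ 2 * s ^ 2 = 1 := by
          calc t ^ 2 * s ^ 2 = t * (t * s ^ 2) := by simp [pow_succ, mul_assoc]
            _ = t * s * (s * t) := by rw [← h5]; simp [pow_succ, mul_assoc]
            _ = 1 := h3
        have h7 := conj_sq_eq h
        have h8 : t ^ 2 = (s ^ 2)⁻¹ := eq_inv_of_mul_eq_one_left h6
        have h9 : s⁻¹ * t ^ 2 * s = t ^ 2 := by rw [h8]; simp [pow_succ, mul_assoc]
        rw [h9, h8, inv_inv] at h7
        rw [h7, mul_assoc, h5]; simp [pow_succ, mul_assoc]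
      have h3 := conj_sq_eq h
      rw [h2] at h3
      have h4 : s⁻¹ * s ^ 2 * s = s ^ 2 := by simp [pow_succ, mul_assoc]
      rw [h4] at h3
      calc s ^ 4 = s ^ 2 * s ^ 2 := by simp [pow_succ, mul_assoc]
        _ = 1 := by nth_rw 1 [h3]; simp [pow_succ, mul_assoc]
    · exact aux _ hst h'
  · exact aux t ht h

/-- If a central element has order greater than `2`, then there is an element of order greater
than `2` that is not reversible. -/
theorem exists_not_reversible (hG : ¬ ∀ a b : G, a * b = b * a) (hs : ∀ a : G, s * a = a * s)
    (hs2 : s ^ 2 ≠ 1) : ∃ x : G, x ^ 2 ≠ 1 ∧ ¬ Reversible x := by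
  by_contra hcon
  push Not at hcon hG
  have hs2c : ∀ a : G, s ^ 2 * a = a * s ^ 2 := fun a => Commute.pow_left (hs a) 2
  obtain ⟨x, y, hxy, hx2⟩ : ∃ x y : G, x * y ≠ y * x ∧ x ^ 2 ≠ 1 := by
    obtain ⟨x, y, hxy⟩ := hG
    by_cases hx : x ^ 2 = 1
    · refine ⟨s * x, y, ?_, ?_⟩
      · intro h; apply hxy
        rw [mul_assoc, ← mul_assoc y, ← hs y, mul_assoc] at h
        exact mul_left_cancel h
      · rw [(show Commute s x from hs x).mul_pow, hx, mul_one]; exact hs2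
    · exact ⟨x, y, hxy, hx⟩
  have hx := hcon x hx2
  have hx4 := hx.pow_four hxy
  have hs4 : s ^ 4 = 1 := by
    have e : (s * x) ^ 4 = s ^ 4 := by
      rw [(show Commute s x from hs x).mul_pow, hx4, mul_one]
    rw [← e]
    by_cases h : (s * x) ^ 2 = 1
    · calc (s * x) ^ 4 = (s * x) ^ 2 * (s * x) ^ 2 := by simp [pow_succ, mul_assoc]
        _ = 1 := by rw [h, mul_one]
    · apply (hcon _ h).pow_four (t := y)
      intro h; apply hxy
      rw [mul_assoc, ← mul_assoc y, ← hs y, mul_assoc] at h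
      exact mul_left_cancel h
  have hz : s ^ 2 * s ^ 2 = 1 := by rw [← hs4]; simp [pow_succ, mul_assoc]
  -- Reversibility of `y` tested against `x` would give `x ^ 2 = y ^ 2`, contradicting `s ^ 2 ≠ 1`.
  have main : ∀ y : G, x * y ≠ y * x → x⁻¹ * y * x = y⁻¹ → y ^ 2 = s ^ 2 * x ^ 2 → False := by
    intro y hxy h1 h2
    have hy2 : y ^ 2 ≠ 1 := by
      intro h
      have : y⁻¹ = y := by rw [inv_eq_iff_mul_eq_one, ← pow_two, h]
      rw [this] at h1
      apply hxy
      nth_rw 1 [← h1]; simp [pow_succ, mul_assoc]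
    have hne : x ^ 2 ≠ y ^ 2 := by
      intro h
      rw [h2] at h
      exact hs2 (right_eq_mul.mp h)
    rcases hcon y hy2 x with h | h | h
    · exact hxy h.symm
    · exact hne (sq_eq_of_conj_eq_inv h1 h).symm
    · exact hne h.2
  have hsy : x * (s * y) ≠ s * y * x := by
    intro h; apply hxy
    rw [← mul_assoc, ← hs x, mul_assoc, mul_assoc] at h
    exact mul_left_cancel h
  have e1 : x⁻¹ * (s * y) * x = s * (x⁻¹ * y * x) := by
    rw [← mul_assoc, ← hs x⁻¹]; simp only [mul_assoc]
  have e2 : (s * y) ^ 2 = s ^ 2 * y ^ 2 := (show Commute s y from hs y).mul_pow 2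
  have e3 : (s * y)⁻¹ = s⁻¹ * y⁻¹ := by rw [mul_inv_rev]; exact (((show Commute s y from hs y).inv_inv)).symm
  -- The test elements `y` and `s * y` have squares differing by `s ^ 2`. Two equal alternatives
  -- force `s ^ 2 = 1`; two different ones are excluded by `main`.
  rcases hx y with h | h | ⟨-, h⟩
  · exact hxy h
  · rcases hx (s * y) with h' | h' | ⟨-, h'⟩
    · exact hsy h'
    · rw [e1, h, e3] at h'
      have := mul_right_cancel h'
      apply hs2
      rw [pow_two]; nth_rw 1 [this]; simp
    · refine main y hxy h ?_
      rw [e2] at h'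
      rw [← h', ← mul_assoc, hz, one_mul]
  · rcases hx (s * y) with h' | h' | ⟨-, h'⟩
    · exact hsy h'
    · refine main _ hsy h' ?_
      rw [e2, h]
    · rw [e2, h] at h'
      exact hs2 (mul_eq_right.mp h')

/-- If `c` were reversible, testing it against `t` would give `t ^ 2 = c ^ 2`. Then `p = s * c⁻¹ *
t` has square `s ^ 2`, and the three alternatives for `c` against `p` give `t ^ 2 = 1`, `t ^ 2 = s ^
2` and `c ^ 2 = s ^ 2`. -/
theorem not_reversible_of_conj_eq_inv
    (hs4 : s ^ 2 * s ^ 2 = 1)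
    (hst : s⁻¹ * t * s = t⁻¹) (ht2 : t ^ 2 ≠ 1) (htz : t ^ 2 ≠ s ^ 2) (hsc : s * c = c * s)
    (hc2 : c ^ 2 ≠ 1) (hcz : c ^ 2 ≠ s ^ 2) (htc : t⁻¹ * c * t = c⁻¹) : ¬ Reversible c := by
  intro hc
  have hct : c * t ≠ t * c := by
    intro h
    rw [mul_assoc, h, inv_mul_cancel_left] at htc
    apply hc2
    rw [pow_two]; nth_rw 1 [htc]; simp
  have htc2 : t ^ 2 = c ^ 2 := by
    rcases hc t with h | h | h
    · exact absurd h hct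
    · exact sq_eq_of_conj_eq_inv h htc
    · exact h.2
  have hc4 : c ^ 4 = 1 := hc.pow_four hct
  have e1 : c * t = t * c⁻¹ := by rw [← htc]; simp [pow_succ, mul_assoc]
  have e2 : t * c = c⁻¹ * t := by
    calc t * c = t * (t⁻¹ * c⁻¹ * t) := by rw [conj_inv_eq htc]
      _ = c⁻¹ * t := by simp [mul_assoc]
  have e3 : c * t * c⁻¹ = t⁻¹ := by
    rw [e1]
    calc t * c⁻¹ * c⁻¹ = t * (c ^ 2)⁻¹ := by simp [pow_succ, mul_assoc]
      _ = t⁻¹ := by rw [← htc2]; simp [pow_succ, mul_assoc]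
  have e4 : c⁻¹ * s = s * c⁻¹ := ((show Commute s c from hsc).inv_right).eq.symm
  set p := s * c⁻¹ * t with hp
  have e5 : c * p * c⁻¹ = s * c⁻¹ * t⁻¹ := by
    calc c * p * c⁻¹ = c * s * c⁻¹ * t * c⁻¹ := by rw [hp]; simp [pow_succ, mul_assoc]
      _ = s * c⁻¹ * (c * t * c⁻¹) := by rw [← hsc]; simp [pow_succ, mul_assoc]
      _ = _ := by rw [e3]
  have e6 : p ^ 2 = s ^ 2 := by
    calc p ^ 2 = s * (c⁻¹ * t * (s * c⁻¹)) * t := by rw [hp]; simp [pow_succ, mul_assoc]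
      _ = s * (c⁻¹ * s * (s⁻¹ * t * s) * c⁻¹) * t := by simp [pow_succ, mul_assoc]
      _ = s * (s * c⁻¹ * t⁻¹ * c⁻¹) * t := by rw [hst, e4]
      _ = s ^ 2 * c⁻¹ * (t⁻¹ * c * t)⁻¹ := by simp [pow_succ, mul_assoc]
      _ = s ^ 2 := by rw [htc]; simp [pow_succ, mul_assoc]
  rcases hc p with h | h | h
  · rw [h, mul_inv_cancel_right, hp] at e5
    have := mul_left_cancel e5
    apply ht2
    rw [pow_two]; nth_rw 1 [this]; simp
  · have h1 : c * p⁻¹ * c⁻¹ = p := by rw [← h]; simp [pow_succ, mul_assoc]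
    have h2 : c * p * c⁻¹ = p⁻¹ := by
      have := congrArg (·⁻¹) h1
      simpa [mul_assoc] using this
    have h3 : p⁻¹ = p * s ^ 2 := by
      rw [inv_eq_iff_mul_eq_one, ← mul_assoc, ← pow_two, e6, hs4]
    rw [h2, h3, hp, mul_assoc] at e5
    have h4 := mul_left_cancel e5
    apply htz
    have h5 : t ^ 2 * s ^ 2 = 1 := by rw [pow_two t, mul_assoc, h4]; simp
    calc t ^ 2 = t ^ 2 * (s ^ 2 * s ^ 2) := by rw [hs4, mul_one]
      _ = s ^ 2 := by rw [← mul_assoc, h5, one_mul]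
  · exact hcz (h.2.symm.trans e6)

end GroupTheory

/-! ### Recognizing generalized dicyclic groups -/

section Dicyclic

variable {G : Type*} [Group G] {s t c : G}

theorem orderOf_eq_four (h2 : s ^ 2 ≠ 1) (h4 : s ^ 4 = 1) : orderOf s = 4 := by
  have := orderOf_eq_prime_pow (p := 2) (n := 1) (x := s) (by simpa using h2) (by simpa using h4)
  simpa using this

/-- Otherwise, by the previous lemma, `t` inverts neither `c` nor `s * c`. But `s * c * t` either
has square `s ^ 2`, and then `t` inverts `c`, or is inverted by `s`, and then `t` inverts `s * c`.
-/
theorem Reversible.sq_eq_one_or_sq_eq (hs : Reversible s)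
    (hst : s * t ≠ t * s) (ht : t ^ 2 ≠ s ^ 2) (hsc : s * c = c * s) (hc : Reversible c)
    (hsc' : Reversible (s * c)) : c ^ 2 = 1 ∨ c ^ 2 = s ^ 2 := by
  by_contra hcon
  push Not at hcon
  obtain ⟨hc2, hcz⟩ := hcon
  have hs4 : s ^ 2 * s ^ 2 = 1 := by rw [← pow_add]; exact hs.pow_four hst
  have inv_of : ∀ u, s * u ≠ u * s → u ^ 2 ≠ s ^ 2 → s⁻¹ * u * s = u⁻¹ := fun u h1 h2 => by
    rcases hs u with h | h | h
    · exact absurd h h1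
    · exact h
    · exact absurd h.2 h2
  have ht' := inv_of t hst ht
  have ht2 : t ^ 2 ≠ 1 := by
    intro h
    have : t⁻¹ = t := by rw [inv_eq_iff_mul_eq_one, ← pow_two, h]
    rw [this] at ht'
    apply hst
    nth_rw 1 [← ht']; simp [mul_assoc]
  have hcomm : Commute s c := hsc
  have e2 : (s * c) ^ 2 = s ^ 2 * c ^ 2 := hcomm.mul_pow 2
  have hA : t⁻¹ * c * t ≠ c⁻¹ := fun h =>
    not_reversible_of_conj_eq_inv hs4 ht' ht2 ht hsc hc2 hcz h hc
  have hB : t⁻¹ * (s * c) * t ≠ (s * c)⁻¹ := fun h => by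
    refine not_reversible_of_conj_eq_inv hs4 ht' ht2 ht (c := s * c) ?_ ?_ ?_ h hsc'
    · rw [mul_assoc, ← hsc]
    · rw [e2]; intro h
      apply hcz
      calc c ^ 2 = s ^ 2 * s ^ 2 * c ^ 2 := by rw [hs4, one_mul]
        _ = s ^ 2 := by rw [mul_assoc, h, mul_one]
    · rw [e2]; intro h; exact hc2 (mul_eq_left.mp h)
  have hsct : s * (s * c * t) ≠ s * c * t * s := by
    intro h; apply hst
    have h1 : s * (s * c * t) = s * c * (s * t) := by
      calc s * (s * c * t) = s * (s * c) * t := by rw [← mul_assoc]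
        _ = s * (c * s) * t := by rw [hsc]
        _ = s * c * (s * t) := by simp only [mul_assoc]
    rw [h1, mul_assoc (s * c)] at h
    exact mul_left_cancel h
  by_cases h : (s * c * t) ^ 2 = s ^ 2
  · apply hA
    have h1 : (s * c * t) ^ 2 = s ^ 2 * c * (t⁻¹ * c * t) := by
      calc (s * c * t) ^ 2 = s * c * s * (s⁻¹ * t * s) * c * t := by simp [pow_succ, mul_assoc]
        _ = s * (c * s) * t⁻¹ * c * t := by rw [ht']; simp [mul_assoc]
        _ = _ := by rw [← hsc]; simp [pow_succ, mul_assoc]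
    rw [h1, mul_assoc] at h
    exact (inv_eq_of_mul_eq_one_right (mul_eq_left.mp h)).symm
  · have h1 := inv_of _ hsct h
    have h2 : s⁻¹ * (s * c * t) * s = s * c * t⁻¹ := by
      calc s⁻¹ * (s * c * t) * s = c * s * (s⁻¹ * t * s) := by simp [mul_assoc]
        _ = _ := by rw [ht', hsc]
    rw [h2] at h1
    apply hB
    have h3 : s * c = t⁻¹ * (s * c)⁻¹ * t := by
      calc s * c = s * c * t⁻¹ * t := by simp [mul_assoc]
        _ = _ := by rw [h1]; simp [mul_assoc]
    have h4 := congrArg (·⁻¹) h3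
    simp only [mul_inv_rev, inv_inv] at h4 ⊢
    rw [h4]; simp [mul_assoc]

theorem isGeneralizedDicyclic_of_index (hG : ¬ ∀ a b : G, a * b = b * a) {A : Subgroup G} {x : G}
    (hx : x ∉ A) (hA : ∀ g, g ∉ A → x * g ∈ A) (hab : ∀ a ∈ A, ∀ b ∈ A, a * b = b * a)
    (hx2 : x ^ 2 ≠ 1) (hx4 : x ^ 4 = 1) (hinv : ∀ a ∈ A, x⁻¹ * a * x = a⁻¹) :
    IsGeneralizedDicyclic G := by
  have hidx : A.index = 2 := by
    rw [Subgroup.index_eq_two_iff']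
    refine ⟨x, fun b => ?_⟩
    by_cases hb : b ∈ A
    · right; exact ⟨hb, fun h => hx ((A.mul_mem_cancel_right hb).mp h)⟩
    · left; exact ⟨hA b hb, hb⟩
  refine ⟨hG, A, Subgroup.normal_of_index_eq_two hidx, hidx, hab, x, hx,
    orderOf_eq_four hx2 hx4, fun a ha => ?_⟩
  have h := hinv a⁻¹ (A.inv_mem ha)
  rw [inv_inv] at h
  nth_rw 1 [← h]; simp [mul_assoc]

/-- The abelian subgroup is the centralizer of `s`. For `c` in it, `t * c` does not commute with
`s`, so `(t * c) ^ 2 = t ^ 2` and `t` inverts `c`; a group on which inversion is a homomorphism is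
abelian. -/
theorem isGeneralizedDicyclic_of_sq_eq (hs2 : s ^ 2 ≠ 1) (hs4 : s ^ 4 = 1)
    (hst : s * t ≠ t * s) (h : ∀ t : G, s * t ≠ t * s → t ^ 2 = s ^ 2) :
    IsGeneralizedDicyclic G := by
  have mem : ∀ c, c ∈ Subgroup.centralizer {s} ↔ s * c = c * s := fun c => by
    rw [Subgroup.mem_centralizer_singleton_iff]; exact eq_comm
  have inv : ∀ t : G, s * t ≠ t * s → ∀ c, s * c = c * s → t⁻¹ * c * t = c⁻¹ := by
    intro t ht c hc
    have h1 : s * (t * c) ≠ t * c * s := by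
      intro h1; apply ht
      rw [mul_assoc, ← hc, ← mul_assoc, ← mul_assoc] at h1
      exact mul_right_cancel h1
    apply conj_eq_inv_of_sq_eq
    rw [h _ h1, h _ ht]
  have ht2 : t ^ 2 = s ^ 2 := h t hst
  refine isGeneralizedDicyclic_of_index (fun h => hst (h s t)) (A := Subgroup.centralizer {s})
    (x := t) ?_ ?_ ?_ (by rwa [ht2]) ?_ ?_
  · rw [mem]; exact hst
  · intro g hg
    rw [mem] at hg ⊢
    have h1 := conj_inv_eq (inv t hst s rfl)
    have h2 := inv g hg s rfl
    have h3 : s * g = g * s⁻¹ := by rw [← h2]; simp [mul_assoc]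
    have h4 : t * s = s⁻¹ * t := by
      nth_rw 1 [← h1]
      simp [mul_assoc]
    have h5 : s * t = t * s⁻¹ := by
      rw [← inv t hst s rfl]; simp [mul_assoc]
    calc s * (t * g) = s * t * g := by rw [mul_assoc]
      _ = t * (s⁻¹ * g) := by rw [h5, mul_assoc]
      _ = t * (g * s) := by
        congr 1
        have := conj_inv_eq h2
        nth_rw 2 [← this]; simp [mul_assoc]
      _ = t * g * s := by rw [mul_assoc]
  · intro a ha b hb
    rw [mem] at ha hb
    have hab : s * (a * b) = a * b * s := (Commute.mul_right ha hb).eq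
    have h1 := inv t hst _ ha
    have h2 := inv t hst _ hb
    have h3 := inv t hst _ hab
    have h4 : t⁻¹ * (a * b) * t = t⁻¹ * a * t * (t⁻¹ * b * t) := by simp [mul_assoc]
    rw [h4, h1, h2, mul_inv_rev] at h3
    have := congrArg (·⁻¹) h3
    simpa using this.symm
  · rw [show t ^ 4 = t ^ 2 * t ^ 2 by rw [← pow_add], ht2, ← pow_add]; exact hs4
  · intro a ha
    exact inv t hst a ((mem a).mp ha)

/-- The abelian subgroup is the centralizer of `t`. Elements with square different from `s ^ 2` lie
in it, commute with each other and are inverted by `s`. Multiplication by `t` brings the other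
elements of the centralizer into this class. -/
theorem isGeneralizedDicyclic_of_conj_eq_inv (hs2 : s ^ 2 ≠ 1) (hs4 : s ^ 4 = 1)
    (hst : s * t ≠ t * s) (ht : t ^ 2 ≠ s ^ 2)
    (hinv : ∀ u : G, u ^ 2 ≠ s ^ 2 → s⁻¹ * u * s = u⁻¹)
    (hcomm : ∀ t u : G, s * t ≠ t * s → t ^ 2 ≠ s ^ 2 → u ^ 2 ≠ s ^ 2 → t * u = u * t) :
    IsGeneralizedDicyclic G := by
  have sq_one : ∀ u : G, u ^ 2 = 1 → u⁻¹ = u := fun u h => by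
    rw [inv_eq_iff_mul_eq_one, ← pow_two, h]
  have ht2 : t ^ 2 ≠ 1 := by
    intro h
    have h1 := hinv t ht
    rw [sq_one t h] at h1
    apply hst
    nth_rw 1 [← h1]; simp [mul_assoc]
  have mem : ∀ c, c ∈ Subgroup.centralizer {t} ↔ t * c = c * t := fun c => by
    rw [Subgroup.mem_centralizer_singleton_iff]; exact eq_comm
  have memD : ∀ u, u ^ 2 ≠ s ^ 2 → u ∈ Subgroup.centralizer {t} := fun u hu =>
    (mem u).mpr (hcomm t u hst ht hu)
  have htA : t ∈ Subgroup.centralizer {t} := (mem t).mpr rfl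
  have comm_D : ∀ a b : G, a ^ 2 ≠ s ^ 2 → b ^ 2 ≠ s ^ 2 → a * b = b * a := by
    intro a b ha hb
    by_cases hsa : s * a = a * s
    · have h1 := hinv a ha
      rw [mul_assoc, ← hsa, inv_mul_cancel_left] at h1
      have ha2 : a ^ 2 = 1 := by rw [pow_two]; nth_rw 1 [h1]; simp
      have hta := hcomm t a hst ht ha
      have h2 : (t * a) ^ 2 ≠ s ^ 2 := by
        rw [(show Commute t a from hta).mul_pow, ha2, mul_one]; exact ht
      have h3 : s * (t * a) ≠ t * a * s := by
        intro h3; apply hst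
        rw [mul_assoc, ← hsa, ← mul_assoc, ← mul_assoc] at h3
        exact mul_right_cancel h3
      have h4 := hcomm _ b h3 h2 hb
      have h5 := hcomm t b hst ht hb
      have h6 : t * (a * b) = t * (b * a) := by
        rw [← mul_assoc, h4, ← mul_assoc, ← h5, mul_assoc]
      exact mul_left_cancel h6
    · exact hcomm a b hsa ha hb
  have shift : ∀ a ∈ Subgroup.centralizer {t}, a ^ 2 = s ^ 2 → (a * t) ^ 2 ≠ s ^ 2 := by
    intro a ha h1 h2
    rw [(show Commute a t from ((mem a).mp ha).symm).mul_pow, h1] at h2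
    exact ht2 (mul_eq_left.mp h2)
  have comm_t : ∀ a ∈ Subgroup.centralizer {t}, ∀ b, a * t * b = b * (a * t) → t * b = b * t →
      a * b = b * a := by
    intro a ha b h1 h2
    apply mul_right_cancel (b := t)
    rw [mul_assoc, ← h2, ← mul_assoc, h1, mul_assoc]
  have hab : ∀ a ∈ Subgroup.centralizer {t}, ∀ b ∈ Subgroup.centralizer {t},
      a * b = b * a := by
    have aux : ∀ a ∈ Subgroup.centralizer {t}, ∀ b, b ^ 2 ≠ s ^ 2 → a * b = b * a := by
      intro a ha b hb
      by_cases h : a ^ 2 = s ^ 2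
      · exact comm_t a ha b (comm_D _ _ (shift a ha h) hb) (hcomm t b hst ht hb)
      · exact comm_D a b h hb
    intro a ha b hb
    by_cases h : b ^ 2 = s ^ 2
    · exact (comm_t b hb a (aux a ha _ (shift b hb h)).symm ((mem a).mp ha)).symm
    · exact aux a ha b h
  refine isGeneralizedDicyclic_of_index (fun h => hst (h s t)) (A := Subgroup.centralizer {t})
    (x := s) ?_ ?_ hab hs2 hs4 ?_
  · rw [mem]; exact fun h => hst h.symm
  · intro g hg
    by_cases h1 : (s * g) ^ 2 = s ^ 2
    swap
    · exact memD _ h1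
    -- If both squares equal `s ^ 2`, then `s * g` inverts `t`, as `s` does, so `g` centralizes `t`.
    by_cases h2 : (s * g * t) ^ 2 = s ^ 2
    swap
    · have := memD _ h2
      exact ((Subgroup.mul_mem_cancel_right _ htA).mp this)
    exfalso
    have h3 : (s * g)⁻¹ * t * (s * g) = t⁻¹ := by
      have h4 : (s * g * t) ^ 2 = (s * g) ^ 2 := by rw [h1, h2]
      exact conj_eq_inv_of_sq_eq h4
    have h6 : g⁻¹ * t⁻¹ * g = t⁻¹ := by
      calc g⁻¹ * t⁻¹ * g = g⁻¹ * (s⁻¹ * t * s) * g := by rw [hinv t ht]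
        _ = (s * g)⁻¹ * t * (s * g) := by simp [mul_assoc]
        _ = t⁻¹ := h3
    apply hg
    rw [mem]
    have h7 := congrArg (·⁻¹) h6
    simp only [mul_inv_rev, inv_inv] at h7
    nth_rw 2 [← h7]; simp [mul_assoc]
  · intro a ha
    by_cases h : a ^ 2 = s ^ 2
    · have h1 := hinv _ (shift a ha h)
      have h2 : s⁻¹ * (a * t) * s = s⁻¹ * a * s * (s⁻¹ * t * s) := by simp [mul_assoc]
      rw [h2, hinv t ht, mul_inv_rev] at h1
      have h3 : t⁻¹ * a⁻¹ = a⁻¹ * t⁻¹ := by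
        rw [← mul_inv_rev, ← mul_inv_rev, (mem a).mp ha]
      rw [h3] at h1
      exact mul_right_cancel h1
    · exact hinv a h

end Dicyclic

/-! ### Few colours determine all orientations -/

section Rigidity

variable {G : Type*} [Group G] {s : G}

theorem forced_five_of_central (hG : ¬ ∀ a b : G, a * b = b * a)
    (hs : ∀ a : G, s * a = a * s) (hs2 : s ^ 2 ≠ 1) : Forced 5 s := by
  obtain ⟨x, hx2, hx⟩ := exists_not_reversible hG hs hs2
  exact (forced_three_of_not_reversible hx).of_commute (hs x) hx2

/-- In a group that is neither abelian nor generalized dicyclic, the orientation of the edges of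
any colour is determined by at most seven colours. -/
theorem forced_seven (hG : ¬ ∀ a b : G, a * b = b * a) (hdic : ¬ IsGeneralizedDicyclic G)
    (s : G) : Forced 7 s := by
  by_contra hs
  have hs2 : s ^ 2 ≠ 1 := fun h => hs ((forced_one_of_sq_eq_one h).mono (by norm_num))
  have hrev : ∀ {x : G}, ¬ Forced 3 x → Reversible x := fun {x} h => by
    by_contra hx; exact h (forced_three_of_not_reversible hx)
  have hncentral : ∃ t, s * t ≠ t * s := by
    by_contra h
    push Not at h
    exact hs ((forced_five_of_central hG h hs2).mono (by norm_num))
  have inv_of_sq_ne : ∀ x t : G, ¬ Forced 5 x → x ^ 2 ≠ 1 → x * t ≠ t * x → t ^ 2 ≠ x ^ 2 →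
      ∀ u : G, u ^ 2 ≠ x ^ 2 → x⁻¹ * u * x = u⁻¹ := by
    intro x t hx hx2 hxt ht u hu
    have hxr : Reversible x := hrev fun h => hx (h.mono (by norm_num))
    -- A non-reversible `c` commuting with `x` would make `x` forced with 3 + 2 colours.
    have hrevc : ∀ c : G, x * c = c * x → c ^ 2 ≠ 1 → Reversible c := fun c hc hc2 =>
      hrev fun h => hx (h.of_commute hc hc2)
    rcases hxr u with h | h | h
    · have hu2 : u ^ 2 = 1 := by
        by_contra hu2
        have hxu2 : (x * u) ^ 2 ≠ 1 := by
          rw [(show Commute x u from h).mul_pow]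
          intro h1
          have h2 : x ^ 2 * x ^ 2 = 1 := by rw [← pow_add]; exact hxr.pow_four hxt
          exact hu (mul_left_cancel (h1.trans h2.symm))
        rcases hxr.sq_eq_one_or_sq_eq hxt ht h (hrevc u h hu2)
          (hrevc (x * u) (by rw [mul_assoc, ← h]) hxu2) with h | h
        · exact hu2 h
        · exact hu h
      rw [mul_assoc, ← h, inv_mul_cancel_left, eq_inv_iff_mul_eq_one, ← pow_two, hu2]
    · exact h
    · exact absurd h.2 hu
  have hsr : Reversible s := hrev fun h => hs (h.mono (by norm_num))
  have hs5 : ¬ Forced 5 s := fun h => hs (h.mono (by norm_num))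
  obtain ⟨t', ht'⟩ := hncentral
  have hs4 := hsr.pow_four ht'
  by_cases h : ∀ t : G, s * t ≠ t * s → t ^ 2 = s ^ 2
  · exact hdic (isGeneralizedDicyclic_of_sq_eq hs2 hs4 ht' h)
  push Not at h
  obtain ⟨t, hst, ht⟩ := h
  have hinv := inv_of_sq_ne s t hs5 hs2 hst ht
  refine hdic (isGeneralizedDicyclic_of_conj_eq_inv hs2 hs4 hst ht hinv ?_)
  intro t u hst ht hu
  have h1 : (s * t) ^ 2 = s ^ 2 := sq_mul_of_conj_eq_inv (hinv t ht)
  -- Here 5 + 2 gives the constant seven. Since `s * t` has the same square as `s`, it inverts `u`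
  -- as well, so `t` centralizes `u`.
  have hst5 : ¬ Forced 5 (s * t) := by
    intro h
    refine hs (h.of_mul hst ?_)
    intro h2
    have h3 : s ^ 2 * s ^ 2 = 1 := by rw [← pow_add]; exact hs4
    exact ht (mul_left_cancel (h2.trans h3.symm))
  have hstt : s * t * t ≠ t * (s * t) := by
    intro h; apply hst
    rw [← mul_assoc] at h
    exact mul_right_cancel h
  have h2 := inv_of_sq_ne (s * t) t hst5 (by rwa [h1]) hstt (by rwa [h1]) u (by rwa [h1])
  have h3 : t⁻¹ * u⁻¹ * t = u⁻¹ := by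
    calc t⁻¹ * u⁻¹ * t = t⁻¹ * (s⁻¹ * u * s) * t := by rw [hinv u hu]
      _ = (s * t)⁻¹ * u * (s * t) := by simp [mul_assoc]
      _ = u⁻¹ := h2
  have h4 : t⁻¹ * u * t = u := by
    have := congrArg (·⁻¹) h3
    simpa [mul_assoc] using this
  calc t * u = t * (t⁻¹ * u * t) := by rw [h4]
    _ = u * t := by simp [mul_assoc]

/-- A non-central reversible `s` with `s ^ 2 ≠ 1` has order 4, and its square is a non-trivial
element of the centre, which is characteristic and abelian. -/
theorem not_reversible_of_noOrderFourOrNoCharAbelian (h : NoOrderFourOrNoCharAbelian G) {t : G}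
    (hst : s * t ≠ t * s) (hs2 : s ^ 2 ≠ 1) : ¬ Reversible s := by
  intro hs
  rcases h with h | h
  · exact h s (orderOf_eq_four hs2 (hs.pow_four hst))
  · have h1 : s ^ 2 ∈ Subgroup.center G :=
      Subgroup.mem_center_iff.mpr fun g => (hs.sq_commute g).symm
    rw [h _ inferInstance fun a ha b _ => (Subgroup.mem_center_iff.mp ha b).symm] at h1
    exact hs2 (Subgroup.mem_bot.mp h1)

variable {S : Finset G}

theorem exists_mem_not_commute (hG : ¬ ∀ a b : G, a * b = b * a)
    (hS : Subgroup.closure (S : Set G) = ⊤) :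
    ∃ s ∈ S, ∃ t ∈ S, s * t ≠ t * s := by
  by_contra hcon
  push Not at hcon
  apply hG
  have h1 : ∀ s ∈ S, ∀ a, s * a = a * s := by
    intro s hs
    have h2 : Subgroup.closure (S : Set G) ≤ Subgroup.centralizer {s} := by
      rw [Subgroup.closure_le]
      intro t ht
      exact Subgroup.mem_centralizer_singleton_iff.mpr (hcon t ht s hs)
    intro a
    have : a ∈ Subgroup.centralizer {s} := h2 (hS ▸ Subgroup.mem_top a)
    exact (Subgroup.mem_centralizer_singleton_iff.mp this).symm
  have h3 : Subgroup.closure (S : Set G) ≤ Subgroup.center G := by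
    rw [Subgroup.closure_le]
    intro s hs
    exact Subgroup.mem_center_iff.mpr fun a => (h1 s hs a).symm
  intro a b
  exact (Subgroup.mem_center_iff.mp (h3 (hS ▸ Subgroup.mem_top a)) b).symm

theorem two_le_card (hG : ¬ ∀ a b : G, a * b = b * a)
    (hS : Subgroup.closure (S : Set G) = ⊤) : 2 ≤ S.card := by
  obtain ⟨s, hs, t, ht, hst⟩ := exists_mem_not_commute hG hS
  refine Finset.one_lt_card.mpr ⟨s, hs, t, ht, ?_⟩
  rintro rfl; exact hst rfl

open Classical in
theorem exists_colours_of_forced {k : ℕ} (h : ∀ s ∈ S, Forced k s) :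
    ∃ W : Finset G, S ⊆ W ∧ W.card ≤ k * S.card ∧
      ∀ φ : G → G, (∀ w ∈ W, PreservesColour φ w) → ∀ s ∈ S, PreservesEdges φ s := by
  choose! W hW using h
  refine ⟨S.biUnion W, fun s hs => Finset.mem_biUnion.mpr ⟨s, hs, (hW s hs).2.1⟩, ?_, ?_⟩
  · rw [mul_comm]
    exact Finset.card_biUnion_le_card_mul _ _ _ fun s hs => (hW s hs).1
  · intro φ hφ s hs
    exact (hW s hs).2.2 φ fun w hw => hφ w (Finset.mem_biUnion.mpr ⟨s, hs, hw⟩)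

open Classical in
theorem exists_colours_of_noOrderFourOrNoCharAbelian (hG : ¬ ∀ a b : G, a * b = b * a)
    (hS : Subgroup.closure (S : Set G) = ⊤) (h : NoOrderFourOrNoCharAbelian G) :
    ∃ W : Finset G, S ⊆ W ∧ W.card ≤ 3 * S.card ∧
      ∀ φ : G → G, (∀ w ∈ W, PreservesColour φ w) → ∀ s ∈ S, PreservesEdges φ s := by
  have forced_of : ∀ s t : G, s * t ≠ t * s → Forced 3 s := by
    intro s t hst
    by_cases hs2 : s ^ 2 = 1
    · exact (forced_one_of_sq_eq_one hs2).mono (by norm_num)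
    · exact forced_three_of_not_reversible
        (not_reversible_of_noOrderFourOrNoCharAbelian h hst hs2)
  obtain ⟨a, ha, b, hb, hab⟩ := exists_mem_not_commute hG hS
  -- Non-central elements cost three colours. A central `s` costs only `s` and `s * t`, once some
  -- non-central `t ∈ S` with `t ^ 2 ≠ 1` is oriented.
  by_cases hx : ∃ t ∈ S, t ^ 2 ≠ 1 ∧ ∃ u, t * u ≠ u * t
  · obtain ⟨t, htS, ht2, u, htu⟩ := hx
    have hW : ∀ s : G, ∃ W : Finset G, W.card ≤ 3 ∧ s ∈ W ∧ ∀ φ : G → G,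
        (∀ w ∈ W, PreservesColour φ w) → ((∃ u, s * u ≠ u * s) ∨ PreservesEdges φ t) →
          PreservesEdges φ s := by
      intro s
      by_cases hs : ∃ u, s * u ≠ u * s
      · obtain ⟨W, h1, h2, h3⟩ := forced_of s _ hs.choose_spec
        exact ⟨W, h1, h2, fun φ hφ _ => h3 φ hφ⟩
      · refine ⟨{s, s * t}, Finset.card_le_two.trans (by norm_num), by simp, fun φ hφ h => ?_⟩
        have h1 := h.resolve_left hs
        push Not at hs
        exact (hφ s (by simp)).preservesEdges_of_commute h1 (hφ _ (by simp)) (hs t) ht2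
    choose W hW using hW
    refine ⟨S.biUnion W, fun s hs => Finset.mem_biUnion.mpr ⟨s, hs, (hW s).2.1⟩, ?_, ?_⟩
    · rw [mul_comm]
      exact Finset.card_biUnion_le_card_mul _ _ _ fun s hs => (hW s).1
    · intro φ hφ s hs
      have key : ∀ s ∈ S, ((∃ u, s * u ≠ u * s) ∨ PreservesEdges φ t) → PreservesEdges φ s :=
        fun s hs => (hW s).2.2 φ fun w hw => hφ w (Finset.mem_biUnion.mpr ⟨s, hs, hw⟩)
      exact key s hs (Or.inr (key t htS (Or.inl ⟨u, htu⟩)))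
  · push Not at hx
    by_cases hc : ∃ s ∈ S, s ^ 2 ≠ 1
    · obtain ⟨s, hsS, hs2⟩ := hc
      have hs : ∀ u, s * u = u * s := hx s hsS hs2
      have hsa : Commute s a := hs a
      have ha2 : a ^ 2 = 1 := by
        by_contra h
        exact hab (hx a ha h b)
      have hx2 : (s * a) ^ 2 ≠ 1 := by rw [hsa.mul_pow, ha2, mul_one]; exact hs2
      have hxb : s * a * b ≠ b * (s * a) := by
        intro h; apply hab
        rw [← mul_assoc, ← hs b, mul_assoc, mul_assoc] at h
        exact mul_left_cancel h
      obtain ⟨W, h1, h2, h3⟩ := forced_of _ _ hxb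
      -- Here `s * a` plays the role of `t`, though it need not lie in `S`. The involution `a` needs
      -- no partner, so the total `2 * S.card + 2` is at most `3 * S.card`, as `S` has at least two
      -- elements.
      refine ⟨S ∪ ((S.erase a).image (· * (s * a)) ∪ W), Finset.subset_union_left, ?_, ?_⟩
      · have h4 := Finset.card_union_le S ((S.erase a).image (· * (s * a)) ∪ W)
        have h5 := Finset.card_union_le ((S.erase a).image (· * (s * a))) W
        have h6 := Finset.card_image_le (s := S.erase a) (f := (· * (s * a)))
        have h7 := Finset.card_erase_of_mem ha
        have h8 := two_le_card hG hS
        omega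
      · intro φ hφ c hcS
        by_cases hc2 : c ^ 2 = 1
        · obtain ⟨W', h4, h5, h6⟩ := forced_one_of_sq_eq_one hc2
          have : W' = {c} := (Finset.eq_of_subset_of_card_le (by simpa using h5) (by simpa using h4)).symm
          subst this
          apply h6
          intro w hw
          rw [Finset.mem_singleton] at hw
          subst hw
          exact hφ _ (by simp [hcS])
        · refine (hφ c (by simp [hcS])).preservesEdges_of_commute
            (h3 φ fun w hw => hφ w (by simp [hw])) (hφ _ ?_) (hx c hcS hc2 _) hx2
          have : c ≠ a := by rintro rfl; exact hc2 ha2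
          simp only [Finset.mem_union, Finset.mem_image, Finset.mem_erase]
          exact Or.inr (Or.inl ⟨c, ⟨this, hcS⟩, rfl⟩)
    · push Not at hc
      exact exists_colours_of_forced fun s hs =>
        (forced_one_of_sq_eq_one (hc s hs)).mono (by norm_num)

/-- A map preserving the edges of every colour of a generating set is a translation. -/
theorem eq_mulLeft_of_preservesEdges {φ : G → G} (hS : Subgroup.closure (S : Set G) = ⊤)
    (h : ∀ s ∈ S, PreservesEdges φ s) (g : G) : φ g = φ 1 * g := by
  have h1 : ∀ g ∈ Subgroup.closure (S : Set G), ∀ x, φ (x * g) = φ x * g := by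
    intro g hg
    induction hg using Subgroup.closure_induction with
    | mem s hs => exact h s hs
    | one => simp
    | mul a b _ _ ha hb => intro x; rw [← mul_assoc, hb, ha, mul_assoc]
    | inv a _ ha =>
      intro x
      have := ha (x * a⁻¹)
      rw [inv_mul_cancel_right] at this
      rw [this, mul_inv_cancel_right]
  simpa using h1 g (hS ▸ Subgroup.mem_top g) 1

end Rigidity

/-! ### Modifying triangle counts with powers of `g` -/

section Triangles

variable {G : Type*} [Group G]

open Classical in
/-- The number of triangles of the Cayley graph of `T` containing a given edge coloured by `x`. -/
noncomputable def triangleCount (T : Finset G) (x : G) : ℕ :=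
  (T.filter fun y => y⁻¹ * x ∈ T).card

theorem triangleCount_inv {T : Finset G} (hT : ∀ t ∈ T, t⁻¹ ∈ T) (x : G) :
    triangleCount T x⁻¹ = triangleCount T x := by
  have key : ∀ x : G, triangleCount T x ≤ triangleCount T x⁻¹ := by
    intro x
    refine Finset.card_le_card_of_injOn (fun y => x⁻¹ * y) ?_ fun a _ b _ h => mul_left_cancel h
    intro y hy
    simp only [Finset.coe_filter, Set.mem_ofPred_eq] at hy ⊢
    exact ⟨by simpa using hT _ hy.2, by simpa using hT _ hy.1⟩
  exact le_antisymm (by simpa using key x⁻¹) (key x)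

/-- `T` is a symmetric set containing `S` whose new elements lie in few triangles and are not
products of two elements of `S`, and passing from `S` to `T` changes the number of triangles only
for colours satisfying `P`. -/
structure TriangleExtension (S T : Finset G) (P : G → Prop) : Prop where
  subset : S ⊆ T
  inv_mem : ∀ t ∈ T, t⁻¹ ∈ T
  one_notMem : (1 : G) ∉ T
  count_le : ∀ t ∈ T, t ∉ S → triangleCount T t ≤ 6
  mul_ne : ∀ t ∈ T, t ∉ S → ∀ a ∈ S, ∀ b ∈ S, a * b ≠ t
  count_eq : ∀ s ∈ S, ¬ P s → triangleCount T s = triangleCount S s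

theorem TriangleExtension.refl {S : Finset G} (hS : ∀ s ∈ S, s⁻¹ ∈ S) (h1 : (1 : G) ∉ S)
    (P : G → Prop) : TriangleExtension S S P :=
  ⟨subset_rfl, hS, h1, fun _ h h' => absurd h h', fun _ h h' => absurd h h', fun _ _ _ => rfl⟩

/-- The condition `hP` preserves the bound six: an element of `T` outside `S` is not a product of
two elements of `S`, so it does not satisfy `P` and its count is unchanged in `U`. -/
theorem TriangleExtension.trans {S T U : Finset G} {P Q : G → Prop}
    (h : TriangleExtension S T Q) (h' : TriangleExtension T U P) (hPQ : ∀ x, P x → Q x)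
    (hP : ∀ x, P x → x ∈ S ∨ ∃ a ∈ S, ∃ b ∈ S, a * b = x) : TriangleExtension S U Q where
  subset := h.subset.trans h'.subset
  inv_mem := h'.inv_mem
  one_notMem := h'.one_notMem
  count_le t ht htS := by
    by_cases htT : t ∈ T
    · rw [h'.count_eq t htT]
      · exact h.count_le t htT htS
      · intro hPt
        rcases hP t hPt with h1 | ⟨a, ha, b, hb, hab⟩
        · exact htS h1
        · exact h.mul_ne t htT htS a ha b hb hab
    · exact h'.count_le t ht htT
  mul_ne t ht htS a ha b hb := by
    by_cases htT : t ∈ T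
    · exact h.mul_ne t htT htS a ha b hb
    · exact h'.mul_ne t ht htT a (h.subset ha) b (h.subset hb)
  count_eq s hs hQ := by
    rw [h'.count_eq s (h.subset hs) fun hPs => hQ (hPQ s hPs), h.count_eq s hs hQ]

open Classical in
-- The new triangle on `c` comes from `c = (c * u) * u⁻¹`. An old colour gains a triangle only as a
-- product of two new elements, since new elements are not products of two old ones; `hP1` to `hP5`
-- cover these products up to inversion.
theorem exists_triangleExtension_of_ne {S : Finset G} (hS : ∀ s ∈ S, s⁻¹ ∈ S)
    (h1 : (1 : G) ∉ S) {c u : G} (hc : c ∈ S) {P : G → Prop} (hPinv : ∀ x, P x → P x⁻¹)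
    (hPc : P c) (huS : u ∉ S) (hu : ∀ a ∈ S, ∀ b ∈ S, a * b ≠ u) (hvS : c * u ∉ S)
    (hv : ∀ a ∈ S, ∀ b ∈ S, a * b ≠ c * u) (hP1 : u * u ∈ S → P (u * u))
    (hP2 : c * u * u ∈ S → P (c * u * u)) (hP3 : u * (c * u) ∈ S → P (u * (c * u)))
    (hP4 : c * u * (c * u) ∈ S → P (c * u * (c * u)))
    (hP5 : u⁻¹ * (c * u) ∈ S → P (u⁻¹ * (c * u))) :
    ∃ T : Finset G, TriangleExtension S T P ∧ T.card ≤ S.card + 4 ∧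
      triangleCount S c < triangleCount T c := by
  set v := c * u with hvdef
  have hSinv : ∀ {x}, x⁻¹ ∈ S → x ∈ S := fun {x} hx => by simpa using hS _ hx
  set X : Finset G := {u, u⁻¹, v, v⁻¹} with hX
  have hXcard : X.card ≤ 4 := Finset.card_le_four
  have hXinv : ∀ x ∈ X, x⁻¹ ∈ X := by
    intro x hx
    simp only [hX, Finset.mem_insert, Finset.mem_singleton] at hx ⊢
    rcases hx with rfl | rfl | rfl | rfl <;> simp
  have hXmul : ∀ x ∈ X, ∀ a ∈ S, ∀ b ∈ S, a * b ≠ x := by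
    have aux : ∀ x : G, (∀ a ∈ S, ∀ b ∈ S, a * b ≠ x) → ∀ a ∈ S, ∀ b ∈ S, a * b ≠ x⁻¹ := by
      intro x hx a ha b hb h
      refine hx _ (hS b hb) _ (hS a ha) ?_
      rw [← mul_inv_rev, h, inv_inv]
    intro x hx
    simp only [hX, Finset.mem_insert, Finset.mem_singleton] at hx
    rcases hx with rfl | rfl | rfl | rfl
    · exact hu
    · exact aux u hu
    · exact hv
    · exact aux v hv
  have hX1 : (1 : G) ∉ X := fun h => hXmul 1 h c hc c⁻¹ (hS c hc) (mul_inv_cancel c)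
  have hXX : ∀ x ∈ X, ∀ y ∈ X, x * y ∈ S → P (x * y) := by
    have aux : ∀ x y : G, (x * y ∈ S → P (x * y)) → y⁻¹ * x⁻¹ ∈ S → P (y⁻¹ * x⁻¹) := by
      intro x y h h'
      rw [← mul_inv_rev] at h' ⊢
      exact hPinv _ (h (hSinv h'))
    have h5' : v⁻¹ * u ∈ S → P (v⁻¹ * u) := by
      have := aux _ _ hP5
      rwa [inv_inv] at this
    have hvu : v * u⁻¹ = c := by rw [hvdef, mul_inv_cancel_right]
    have huv : u * v⁻¹ = c⁻¹ := by rw [hvdef]; simp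
    intro x hx y hy
    simp only [hX, Finset.mem_insert, Finset.mem_singleton] at hx hy
    rcases hx with rfl | rfl | rfl | rfl <;> rcases hy with rfl | rfl | rfl | rfl
    · exact hP1
    · rw [mul_inv_cancel]; exact fun h => absurd h h1
    · exact hP3
    · rw [huv]; exact fun _ => hPinv _ hPc
    · rw [inv_mul_cancel]; exact fun h => absurd h h1
    · exact aux _ _ hP1
    · exact hP5
    · exact aux _ _ hP2
    · exact hP2
    · rw [hvu]; exact fun _ => hPc
    · exact hP4
    · rw [mul_inv_cancel]; exact fun h => absurd h h1
    · exact h5'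
    · exact aux _ _ hP3
    · rw [inv_mul_cancel]; exact fun h => absurd h h1
    · exact aux _ _ hP4
  have hT1 : (1 : G) ∉ S ∪ X := by simp [h1, hX1]
  have mem_new : ∀ t ∈ S ∪ X, t ∉ S → t ∈ X := fun t ht htS =>
    (Finset.mem_union.mp ht).resolve_left htS
  refine ⟨S ∪ X, ⟨Finset.subset_union_left, ?_, hT1, ?_, ?_, ?_⟩, ?_, ?_⟩
  · intro t ht
    rcases Finset.mem_union.mp ht with h | h
    · exact Finset.mem_union_left _ (hS t h)
    · exact Finset.mem_union_right _ (hXinv t h)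
  · intro t ht htS
    have htX := mem_new t ht htS
    -- One factor of `t` is new and differs from `t`: three choices on either side, hence six
    -- triangles.
    have hsub : ((S ∪ X).filter fun y => y⁻¹ * t ∈ S ∪ X) ⊆
        X.erase t ∪ (X.erase t).image fun w => t * w⁻¹ := by
      intro y hy
      obtain ⟨hy, hw⟩ := Finset.mem_filter.mp hy
      have hyt : y ≠ t := by
        rintro rfl; rw [inv_mul_cancel] at hw; exact hT1 hw
      by_cases hyS : y ∈ S
      · have hwX : y⁻¹ * t ∈ X := by
          refine mem_new _ hw fun hwS => hXmul t htX y hyS _ hwS ?_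
          simp
        refine Finset.mem_union_right _ (Finset.mem_image.mpr ⟨y⁻¹ * t, ?_, by simp⟩)
        refine Finset.mem_erase.mpr ⟨?_, hwX⟩
        intro h
        have : y = 1 := by simpa using h
        exact h1 (this ▸ hyS)
      · exact Finset.mem_union_left _ (Finset.mem_erase.mpr ⟨hyt, mem_new y hy hyS⟩)
    have h2 := Finset.card_le_card hsub
    have h3 := Finset.card_union_le (X.erase t) ((X.erase t).image fun w => t * w⁻¹)
    have h4 := Finset.card_image_le (s := X.erase t) (f := fun w => t * w⁻¹)
    have h5 := Finset.card_erase_of_mem htX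
    unfold triangleCount
    omega
  · exact fun t ht htS => hXmul t (mem_new t ht htS)
  · intro s hs hPs
    unfold triangleCount
    congr 1
    ext y
    simp only [Finset.mem_filter]
    constructor
    · rintro ⟨hy, hw⟩
      by_cases hyS : y ∈ S
      · refine ⟨hyS, ?_⟩
        by_contra hwS
        exact hXmul _ (mem_new _ hw hwS) _ (hS y hyS) s hs rfl
      · have hyX := mem_new y hy hyS
        exfalso
        by_cases hwS : y⁻¹ * s ∈ S
        · exact hXmul y hyX s hs _ (hS _ hwS) (by simp)
        · have := hXX y hyX _ (mem_new _ hw hwS)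
          rw [mul_inv_cancel_left] at this
          exact hPs (this hs)
    · rintro ⟨hy, hw⟩
      exact ⟨Finset.mem_union_left _ hy, Finset.mem_union_left _ hw⟩
  · exact (Finset.card_union_le _ _).trans (by omega)
  · apply Finset.card_lt_card
    refine Finset.ssubset_iff_subset_ne.mpr ⟨?_, ?_⟩
    · intro y hy
      obtain ⟨hy, hw⟩ := Finset.mem_filter.mp hy
      exact Finset.mem_filter.mpr ⟨Finset.mem_union_left _ hy, Finset.mem_union_left _ hw⟩
    · intro h
      have h2 : v ∈ (S ∪ X).filter fun y => y⁻¹ * c ∈ S ∪ X := by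
        refine Finset.mem_filter.mpr ⟨Finset.mem_union_right _ (by simp [hX]),
          Finset.mem_union_right _ ?_⟩
        rw [hvdef]; simp [hX]
      rw [← h] at h2
      exact hvS (Finset.mem_filter.mp h2).1

/-- Union bound: an injective sequence meets a finite set at most as often as its cardinality. -/
theorem exists_lt_forall_notMem {α : Type*} (l : List ((ℕ → α) × Finset α)) (L : ℕ)
    (hinj : ∀ p ∈ l, Set.InjOn p.1 (Set.Iio L)) (hl : (l.map fun p => p.2.card).sum < L) :
    ∃ j < L, ∀ p ∈ l, p.1 j ∉ p.2 := by
  classical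
  have key : ∀ (l : List ((ℕ → α) × Finset α)) (J : Finset ℕ),
      (∀ p ∈ l, Set.InjOn p.1 J) → (l.map fun p => p.2.card).sum < J.card →
      ∃ j ∈ J, ∀ p ∈ l, p.1 j ∉ p.2 := by
    intro l
    induction l with
    | nil =>
      intro J _ h
      obtain ⟨j, hj⟩ := Finset.card_pos.mp (by simpa using h)
      exact ⟨j, hj, by simp⟩
    | cons p l ih =>
      intro J hinj h
      rw [List.map_cons, List.sum_cons] at h
      have h1 : (J.filter fun j => p.1 j ∈ p.2).card ≤ p.2.card := by
        refine Finset.card_le_card_of_injOn p.1 (fun j hj => (Finset.mem_filter.mp hj).2) ?_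
        exact (hinj p (by simp)).mono (Finset.coe_subset.mpr (Finset.filter_subset _ _))
      have h2 := J.card_filter_add_card_filter_not (fun j => p.1 j ∈ p.2)
      obtain ⟨j, hj, hjl⟩ := ih (J.filter fun j => p.1 j ∉ p.2)
        (fun q hq => (hinj q (by simp [hq])).mono
          (Finset.coe_subset.mpr (Finset.filter_subset _ _))) (by omega)
      rw [Finset.mem_filter] at hj
      refine ⟨j, hj.1, ?_⟩
      intro q hq
      rcases List.mem_cons.mp hq with rfl | hq
      · exact hj.2
      · exact hjl q hq
  obtain ⟨j, hj, h⟩ := key l (Finset.range L) (fun p hp => by simpa using hinj p hp)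
    (by simpa using hl)
  exact ⟨j, Finset.mem_range.mp hj, h⟩

/-- Conjugation by `c` inverts one of the powers `g, g ^ 2, …, g ^ L`. -/
def InvertsPower (g : G) (L : ℕ) (c : G) : Prop :=
  ∃ q : ℕ, 1 ≤ q ∧ q ≤ L ∧ c * g ^ q = (g ^ q)⁻¹ * c

/-- The colours whose number of triangles is modified while increasing that of `c`. -/
def Affected (g : G) (L : ℕ) (c x : G) : Prop :=
  x = c ∨ x = c⁻¹ ∨ InvertsPower g L c ∧ (x = c * c ∨ x = c⁻¹ * c⁻¹)

theorem InvertsPower.of_inv {g c : G} {L : ℕ} (h : InvertsPower g L c⁻¹) :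
    InvertsPower g L c := by
  obtain ⟨q, h1, h2, h3⟩ := h
  have := congrArg (·⁻¹) h3
  exact ⟨q, h1, h2, by simpa using this.symm⟩


theorem pow_injOn_of_pow_ne_one {g : G} {M : ℕ} (hg : ∀ k : ℕ, 0 < k → k ≤ M → g ^ k ≠ 1) :
    Set.InjOn (fun k : ℕ => g ^ k) (Set.Iic M) := by
  have key : ∀ a b : ℕ, a ≤ b → b ≤ M → g ^ a = g ^ b → a = b := by
    intro a b hab hb h
    by_contra hne
    refine hg (b - a) (by omega) (by omega) ?_
    rw [pow_sub g hab, h, mul_inv_cancel]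
  intro a ha b hb h
  rcases le_total a b with hab | hab
  · exact key a b hab hb h
  · exact (key b a hab ha h.symm).symm

/-- If `c` inverts `g ^ q`, then `c * c` centralizes it; if `c * c` also inverts `g ^ r`, then `g ^
(2 * (r * q)) = 1`, within the excluded range. -/
theorem InvertsPower.mul_self {g c : G} {L : ℕ}
    (hg : ∀ k : ℕ, 0 < k → k ≤ 2 * L ^ 2 → g ^ k ≠ 1) (h : InvertsPower g L c) :
    ¬ InvertsPower g L (c * c) := by
  rintro ⟨r, hr1, hr2, hr⟩
  obtain ⟨q, hq1, hq2, hq⟩ := h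
  have h1 : SemiconjBy c (g ^ q) (g ^ q)⁻¹ := hq
  have h2 : SemiconjBy c (g ^ q)⁻¹ (g ^ q) := by simpa using h1.inv_right
  have h3 : SemiconjBy (c * c) ((g ^ q) ^ r) ((g ^ q) ^ r) := (h2.mul_left h1).pow_right r
  have h4 : SemiconjBy (c * c) ((g ^ r) ^ q) ((g ^ r)⁻¹ ^ q) :=
    SemiconjBy.pow_right (show SemiconjBy (c * c) (g ^ r) (g ^ r)⁻¹ from hr) q
  rw [← pow_mul, mul_comm q r, pow_mul] at h3
  have h5 : (g ^ r) ^ q = (g ^ r)⁻¹ ^ q := mul_right_cancel (h3.eq.symm.trans h4.eq)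
  refine hg (2 * (r * q)) (by positivity) ?_ ?_
  · nlinarith [Nat.mul_le_mul hr2 hq2]
  · rw [two_mul, pow_add, pow_mul]
    nth_rw 1 [h5]
    rw [inv_pow, inv_mul_cancel]

open Classical in
-- If `c` inverts or centralizes some `g ^ q`, then `u` is a power of it, and `u * c * u` or `u⁻¹ *
-- c * u` is `c` itself. Otherwise these expressions with `u = g ^ j` are injective in `j < L`, so
-- they can be kept out of `S`. This last case is the most expensive: `2 * (n ^ 2 + n) + 5 * n < L`.
theorem exists_triangleExtension_lt {S : Finset G} (hS : ∀ s ∈ S, s⁻¹ ∈ S)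
    (h1 : (1 : G) ∉ S) {g c : G} {n L : ℕ} (hL : L = 2 * n ^ 2 + 7 * n + 1) (hn : S.card ≤ n)
    (hg : ∀ k : ℕ, 0 < k → k ≤ 2 * L ^ 2 → g ^ k ≠ 1) (hc : c ∈ S) :
    ∃ T : Finset G, TriangleExtension S T (Affected g L c) ∧ T.card ≤ S.card + 4 ∧
      triangleCount S c < triangleCount T c := by
  set B : Finset G := S ∪ (S ×ˢ S).image fun p => p.1 * p.2 with hB
  have hBcard : B.card ≤ n + n ^ 2 := by
    have h2 := Finset.card_union_le S ((S ×ˢ S).image fun p => p.1 * p.2)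
    have h3 := Finset.card_image_le (s := S ×ˢ S) (f := fun p => p.1 * p.2)
    rw [Finset.card_product] at h3
    have h4 := Nat.mul_le_mul hn hn
    rw [← hB] at h2
    nlinarith
  have hB1 : ∀ x, x ∉ B → x ∉ S := fun x hx h => hx (Finset.mem_union_left _ h)
  have hB2 : ∀ x, x ∉ B → ∀ a ∈ S, ∀ b ∈ S, a * b ≠ x := fun x hx a ha b hb h =>
    hx (Finset.mem_union_right _ (Finset.mem_image.mpr ⟨(a, b), by simp [ha, hb], h⟩))
  have hPinv : ∀ x, Affected g L c x → Affected g L c x⁻¹ := by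
    rintro x (rfl | rfl | ⟨h, rfl | rfl⟩)
    · exact Or.inr (Or.inl rfl)
    · exact Or.inl (inv_inv _)
    · exact Or.inr (Or.inr ⟨h, Or.inr (mul_inv_rev _ _)⟩)
    · exact Or.inr (Or.inr ⟨h, Or.inl (by simp)⟩)
  have hPc : Affected g L c c := Or.inl rfl
  have hinj := pow_injOn_of_pow_ne_one hg
  have hinj1 : ∀ q, 1 ≤ q → q ≤ L → Set.InjOn (fun j : ℕ => (g ^ q) ^ j) (Set.Iio L) := by
    intro q hq1 hq2 a ha b hb h
    simp only [← pow_mul, Set.mem_Iio] at h ha hb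
    have h2 := hinj (show q * a ∈ Set.Iic (2 * L ^ 2) by
      simp only [Set.mem_Iic]; nlinarith [Nat.mul_le_mul hq2 ha.le])
      (show q * b ∈ Set.Iic (2 * L ^ 2) by
      simp only [Set.mem_Iic]; nlinarith [Nat.mul_le_mul hq2 hb.le]) h
    exact Nat.eq_of_mul_eq_mul_left hq1 h2
  have hinj2 : ∀ q, 1 ≤ q → q ≤ L →
      Set.InjOn (fun j : ℕ => (g ^ q) ^ j * (g ^ q) ^ j) (Set.Iio L) := by
    intro q hq1 hq2 a ha b hb h
    simp only [← pow_mul, ← pow_add, ← two_mul, Set.mem_Iio] at h ha hb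
    have h2 := hinj (show 2 * (q * a) ∈ Set.Iic (2 * L ^ 2) by
      simp only [Set.mem_Iic]; nlinarith [Nat.mul_le_mul hq2 ha.le])
      (show 2 * (q * b) ∈ Set.Iic (2 * L ^ 2) by
      simp only [Set.mem_Iic]; nlinarith [Nat.mul_le_mul hq2 hb.le]) h
    exact Nat.eq_of_mul_eq_mul_left hq1 (Nat.eq_of_mul_eq_mul_left two_pos h2)
  have hmul : ∀ (a : G) (f : ℕ → G), Set.InjOn f (Set.Iio L) →
      Set.InjOn (fun j => a * f j) (Set.Iio L) :=
    fun a f hf x hx y hy h => hf hx hy (mul_left_cancel h)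
  by_cases hA : InvertsPower g L c
  · obtain ⟨q, hq1, hq2, hq⟩ := id hA
    obtain ⟨j, hj, h⟩ := exists_lt_forall_notMem
      [(fun j => (g ^ q) ^ j, B), (fun j => c * (g ^ q) ^ j, B),
        (fun j => (g ^ q) ^ j * (g ^ q) ^ j, S), (fun j => c * ((g ^ q) ^ j * (g ^ q) ^ j), S)] L
      (by
        simp only [List.forall_mem_cons]
        exact ⟨hinj1 q hq1 hq2, hmul _ _ (hinj1 q hq1 hq2), hinj2 q hq1 hq2,
          hmul _ _ (hinj2 q hq1 hq2), by simp⟩)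
      (by simp only [List.map_cons, List.map_nil, List.sum_cons, List.sum_nil]; nlinarith)
    simp only [List.forall_mem_cons] at h
    obtain ⟨h2, h3, h4, h5, -⟩ := h
    set u := (g ^ q) ^ j
    have hcu : c * u = u⁻¹ * c := by
      have := SemiconjBy.pow_right (show SemiconjBy c (g ^ q) (g ^ q)⁻¹ from hq) j
      rw [inv_pow] at this
      exact this
    rw [← mul_assoc] at h5
    refine exists_triangleExtension_of_ne hS h1 hc (u := u) hPinv hPc (hB1 _ h2) (hB2 _ h2)
      (hB1 _ h3) (hB2 _ h3) (fun h => absurd h h4) (fun h => absurd h h5) (fun _ => ?_)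
      (fun _ => ?_) (fun h => absurd ?_ h5)
    · rw [hcu, mul_inv_cancel_left]; exact hPc
    · have : c * u * (c * u) = c * c := by
        nth_rw 2 [hcu]; simp [mul_assoc]
      rw [this]; exact Or.inr (Or.inr ⟨hA, Or.inl rfl⟩)
    · rw [hcu, mul_assoc]; exact h
  by_cases hC : ∃ p, 1 ≤ p ∧ p ≤ L ∧ c * g ^ p = g ^ p * c
  · obtain ⟨q, hq1, hq2, hq⟩ := hC
    obtain ⟨j, hj, h⟩ := exists_lt_forall_notMem
      [(fun j => (g ^ q) ^ j, B), (fun j => c * (g ^ q) ^ j, B),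
        (fun j => (g ^ q) ^ j * (g ^ q) ^ j, S), (fun j => c * ((g ^ q) ^ j * (g ^ q) ^ j), S),
        (fun j => c * c * ((g ^ q) ^ j * (g ^ q) ^ j), S)] L
      (by
        simp only [List.forall_mem_cons]
        exact ⟨hinj1 q hq1 hq2, hmul _ _ (hinj1 q hq1 hq2), hinj2 q hq1 hq2,
          hmul _ _ (hinj2 q hq1 hq2), hmul _ _ (hinj2 q hq1 hq2), by simp⟩)
      (by simp only [List.map_cons, List.map_nil, List.sum_cons, List.sum_nil]; nlinarith)
    simp only [List.forall_mem_cons] at h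
    obtain ⟨h2, h3, h4, h5, h6, -⟩ := h
    set u := (g ^ q) ^ j
    have hcu : c * u = u * c :=
      SemiconjBy.pow_right (show SemiconjBy c (g ^ q) (g ^ q) from hq) j
    rw [← mul_assoc] at h5
    refine exists_triangleExtension_of_ne hS h1 hc (u := u) hPinv hPc (hB1 _ h2) (hB2 _ h2)
      (hB1 _ h3) (hB2 _ h3) (fun h => absurd h h4) (fun h => absurd h h5)
      (fun h => absurd ?_ h5) (fun h => absurd ?_ h6) (fun _ => ?_)
    · rw [hcu, mul_assoc]; exact h
    · have : c * u * (c * u) = c * c * (u * u) := by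
        rw [mul_assoc, ← mul_assoc u, ← hcu]; simp only [mul_assoc]
      rwa [← this]
    · rw [hcu, inv_mul_cancel_left]; exact hPc
  have hLpos : 1 ≤ L := by omega
  have diff : ∀ f : ℕ → G, (∀ i d, 1 ≤ d → d ≤ L → f i ≠ f (i + d)) →
      Set.InjOn f (Set.Iio L) := by
    intro f hf a ha b hb h
    simp only [Set.mem_Iio] at ha hb
    by_contra hne
    rcases lt_or_gt_of_ne hne with hab | hab
    · refine hf a (b - a) (by omega) (by omega) ?_
      rw [h]; congr 1; omega
    · refine hf b (a - b) (by omega) (by omega) ?_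
      rw [← h]; congr 1; omega
  have hinj3 : Set.InjOn (fun j => g ^ j * (c * g ^ j)) (Set.Iio L) := by
    refine diff _ fun i d hd1 hd2 h => hA ⟨d, hd1, hd2, ?_⟩
    have h2 : g ^ (i + d) * (c * g ^ (i + d)) = g ^ i * (g ^ d * (c * g ^ d) * g ^ i) := by
      rw [pow_add]; nth_rw 2 [← pow_add]; rw [add_comm, pow_add]; simp only [mul_assoc]
    have h3 := h.trans h2
    have h4 := mul_right_cancel (mul_left_cancel h3)
    nth_rw 2 [h4]
    rw [inv_mul_cancel_left]
  have hinj5 : Set.InjOn (fun j => (g ^ j)⁻¹ * (c * g ^ j)) (Set.Iio L) := by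
    refine diff _ fun i d hd1 hd2 h => hC ⟨d, hd1, hd2, ?_⟩
    have h2 : (g ^ (i + d))⁻¹ * (c * g ^ (i + d)) =
        (g ^ i)⁻¹ * ((g ^ d)⁻¹ * (c * g ^ d) * g ^ i) := by
      rw [add_comm, pow_add, mul_inv_rev]; simp only [mul_assoc]
    have h3 := h.trans h2
    have h4 := mul_right_cancel (mul_left_cancel h3)
    nth_rw 2 [h4]
    rw [mul_inv_cancel_left]
  have hg1 := hinj1 1 le_rfl hLpos
  have hg2 := hinj2 1 le_rfl hLpos
  simp only [pow_one] at hg1 hg2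
  obtain ⟨j, hj, h⟩ := exists_lt_forall_notMem
    [(fun j => g ^ j, B), (fun j => c * g ^ j, B), (fun j => g ^ j * g ^ j, S),
      (fun j => c * (g ^ j * g ^ j), S), (fun j => g ^ j * (c * g ^ j), S),
      (fun j => c * (g ^ j * (c * g ^ j)), S), (fun j => (g ^ j)⁻¹ * (c * g ^ j), S)] L
    (by
      simp only [List.forall_mem_cons]
      exact ⟨hg1, hmul _ _ hg1, hg2, hmul _ _ hg2, hinj3, hmul _ _ hinj3, hinj5, by simp⟩)
    (by simp only [List.map_cons, List.map_nil, List.sum_cons, List.sum_nil]; nlinarith)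
  simp only [List.forall_mem_cons] at h
  obtain ⟨h2, h3, h4, h5, h6, h7, h8, -⟩ := h
  rw [← mul_assoc] at h5 h7
  exact exists_triangleExtension_of_ne hS h1 hc hPinv hPc (hB1 _ h2) (hB2 _ h2)
    (hB1 _ h3) (hB2 _ h3) (fun h => absurd h h4) (fun h => absurd h h5) (fun h => absurd h h6)
    (fun h => absurd h h7) (fun h => absurd h h8)

end Triangles

/-! ### Separating colours one after another -/

section Greedy

variable {G : Type*} [Group G]

theorem Affected.mem_or_mul {S : Finset G} (hS : ∀ s ∈ S, s⁻¹ ∈ S) {g c x : G} {L : ℕ}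
    (hc : c ∈ S) (h : Affected g L c x) : x ∈ S ∨ ∃ a ∈ S, ∃ b ∈ S, a * b = x := by
  rcases h with rfl | rfl | ⟨-, rfl | rfl⟩
  · exact Or.inl hc
  · exact Or.inl (hS c hc)
  · exact Or.inr ⟨c, hc, c, hc, rfl⟩
  · exact Or.inr ⟨c⁻¹, hS c hc, c⁻¹, hS c hc, rfl⟩

/-- The count of `c` is raised while it lies in `Φ`. It increases strictly, so each round uses up
one value of `Φ` and adds at most four elements. -/
theorem exists_triangleExtension_notMem {g : G} {n L : ℕ} (hL : L = 2 * n ^ 2 + 7 * n + 1)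
    (hg : ∀ k : ℕ, 0 < k → k ≤ 2 * L ^ 2 → g ^ k ≠ 1) {c : G} (Φ : Finset ℕ) {S : Finset G}
    (hS : ∀ s ∈ S, s⁻¹ ∈ S) (h1 : (1 : G) ∉ S) (hc : c ∈ S) (hn : S.card + 4 * Φ.card ≤ n) :
    ∃ T : Finset G, TriangleExtension S T (Affected g L c) ∧ T.card ≤ S.card + 4 * Φ.card ∧
      triangleCount S c ≤ triangleCount T c ∧ triangleCount T c ∉ Φ := by
  induction hk : Φ.card using Nat.strong_induction_on generalizing Φ S with
  | _ k ih =>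
    subst hk
    by_cases hΦ : triangleCount S c ∈ Φ
    swap
    · exact ⟨S, .refl hS h1 _, by omega, le_rfl, hΦ⟩
    obtain ⟨S₁, hS₁, hcard, hlt⟩ := exists_triangleExtension_lt hS h1 hL (by omega) hg hc
    set Ψ := Φ.erase (triangleCount S c) with hΨ
    have hΨcard : Ψ.card + 1 = Φ.card := Finset.card_erase_add_one hΦ
    obtain ⟨T, hT, hTcard, hle, hTΨ⟩ := ih Ψ.card (by omega) Ψ hS₁.inv_mem hS₁.one_notMem
      (hS₁.subset hc) (by omega) rfl
    refine ⟨T, hS₁.trans hT (fun _ h => h) fun x hx => hx.mem_or_mul hS hc, by omega, by omega,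
      fun h => hTΨ (Finset.mem_erase.mpr ⟨by omega, h⟩)⟩

/-- The colours in `D ⊆ S` lie in more than six triangles of the Cayley graph of `T`, and are
pairwise distinguished by their number of triangles, up to inversion. -/
structure Separates (S T D : Finset G) : Prop where
  extension : TriangleExtension S T fun _ => True
  lt_count : ∀ d ∈ D, 6 < triangleCount T d
  eq_or_eq_inv : ∀ d ∈ D, ∀ e ∈ D, triangleCount T d = triangleCount T e → d = e ∨ d = e⁻¹
  card_le : T.card ≤ S.card + (2 * D.card ^ 2 + 26 * D.card)

open Classical in
theorem Separates.exists_insert {g : G} {n L : ℕ} (hL : L = 2 * n ^ 2 + 7 * n + 1)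
    (hg : ∀ k : ℕ, 0 < k → k ≤ 2 * L ^ 2 → g ^ k ≠ 1) {S T D : Finset G}
    (hS : ∀ s ∈ S, s⁻¹ ∈ S) (h : Separates S T D) (hD : D ⊆ S) {c : G} (hcS : c ∈ S)
    (hcD : c ∉ D) (hn : S.card + (2 * (D.card + 1) ^ 2 + 26 * (D.card + 1)) ≤ n)
    (hP : ∀ d ∈ D, d = c⁻¹ ∨ ¬ Affected g L c d) :
    ∃ T' : Finset G, Separates S T' (insert c D) := by
  have hcard := h.card_le
  by_cases hcD' : c⁻¹ ∈ D
  · have hcc := triangleCount_inv h.extension.inv_mem c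
    refine ⟨T, h.extension, ?_, ?_, ?_⟩
    · intro d hd
      rcases Finset.mem_insert.mp hd with rfl | hd
      · rw [← hcc]; exact h.lt_count _ hcD'
      · exact h.lt_count d hd
    · intro d hd e he hde
      rcases Finset.mem_insert.mp hd with rfl | hd' <;>
        rcases Finset.mem_insert.mp he with rfl | he'
      · exact Or.inl rfl
      · rw [← hcc] at hde
        rcases h.eq_or_eq_inv _ hcD' e he' hde with h | h
        · exact Or.inr (by rw [← h, inv_inv])
        · exact Or.inl (inv_injective h)
      · rw [← hcc] at hde
        rcases h.eq_or_eq_inv d hd' _ hcD' hde with h | h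
        · exact Or.inr h
        · exact Or.inl (by rw [h, inv_inv])
      · exact h.eq_or_eq_inv d hd' e he' hde
    · rw [Finset.card_insert_of_notMem hcD]; nlinarith
  have hP' : ∀ d ∈ D, ¬ Affected g L c d := fun d hd =>
    (hP d hd).resolve_left fun h => hcD' (h ▸ hd)
  -- Avoiding at most `7 + D.card` values costs `28 + 4 * D.card` elements, the increment of `2 * k
  -- ^ 2 + 26 * k` from `k = D.card` to `k + 1`.
  set Φ : Finset ℕ := Finset.range 7 ∪ D.image (triangleCount T) with hΦ
  have hΦcard : Φ.card ≤ 7 + D.card := by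
    refine (Finset.card_union_le _ _).trans ?_
    rw [Finset.card_range]
    exact Nat.add_le_add_left Finset.card_image_le 7
  obtain ⟨T', hT', hcard', -, hcΦ⟩ := exists_triangleExtension_notMem hL hg Φ
    h.extension.inv_mem h.extension.one_notMem (h.extension.subset hcS) (by nlinarith)
  have heq : ∀ d ∈ D, triangleCount T' d = triangleCount T d := fun d hd =>
    hT'.count_eq d (h.extension.subset (hD hd)) (hP' d hd)
  have hc6 : 6 < triangleCount T' c := by
    by_contra h6
    exact hcΦ (Finset.mem_union_left _ (Finset.mem_range.mpr (by omega)))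
  have hcne : ∀ d ∈ D, triangleCount T' d ≠ triangleCount T' c := fun d hd h6 =>
    hcΦ (Finset.mem_union_right _ (Finset.mem_image.mpr ⟨d, hd, by rw [← heq d hd, h6]⟩))
  refine ⟨T', h.extension.trans hT' (fun _ _ => trivial) fun x hx => hx.mem_or_mul hS hcS,
    ?_, ?_, ?_⟩
  · intro d hd
    rcases Finset.mem_insert.mp hd with rfl | hd
    · exact hc6
    · rw [heq d hd]; exact h.lt_count d hd
  · intro d hd e he hde
    rcases Finset.mem_insert.mp hd with rfl | hd' <;>
      rcases Finset.mem_insert.mp he with rfl | he'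
    · exact Or.inl rfl
    · exact absurd hde.symm (hcne e he')
    · exact absurd hde (hcne d hd')
    · rw [heq d hd', heq e he'] at hde
      exact h.eq_or_eq_inv d hd' e he' hde
  · rw [Finset.card_insert_of_notMem hcD]; nlinarith

open Classical in
-- Colours inverting a power of `g` come first: they may disturb `c * c`, but by
-- `InvertsPower.mul_self` it is not in this class and so not yet treated. The remaining colours
-- disturb only themselves and their inverses.
theorem exists_separates {g : G} {n L : ℕ} (hL : L = 2 * n ^ 2 + 7 * n + 1)
    (hg : ∀ k : ℕ, 0 < k → k ≤ 2 * L ^ 2 → g ^ k ≠ 1) {S W : Finset G}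
    (hS : ∀ s ∈ S, s⁻¹ ∈ S) (h1 : (1 : G) ∉ S) (hW : W ⊆ S)
    (hn : S.card + (2 * W.card ^ 2 + 26 * W.card) ≤ n) :
    ∃ T : Finset G, Separates S T W := by
  have hnD : ∀ D : Finset G, ∀ c, c ∉ D → insert c D ⊆ W →
      S.card + (2 * (D.card + 1) ^ 2 + 26 * (D.card + 1)) ≤ n := by
    intro D c hc hD
    have := Finset.card_le_card hD
    rw [Finset.card_insert_of_notMem hc] at this
    have h2 := Nat.pow_le_pow_left this 2
    omega
  set W₁ := W.filter (InvertsPower g L) with hW₁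
  have hW₁W : W₁ ⊆ W := Finset.filter_subset _ _
  have first : ∀ D : Finset G, D ⊆ W₁ → ∃ T : Finset G, Separates S T D := by
    intro D
    induction D using Finset.induction_on with
    | empty => exact fun _ => ⟨S, .refl hS h1 _, by simp, by simp, by simp⟩
    | insert c D hc ih =>
      intro hD
      obtain ⟨hcW, hDW⟩ := Finset.insert_subset_iff.mp hD
      obtain ⟨T, hT⟩ := ih hDW
      refine hT.exists_insert hL hg hS ((hDW.trans hW₁W).trans hW) (hW (hW₁W hcW)) hc
        (hnD D c hc (hD.trans hW₁W)) ?_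
      intro d hd
      have hdI : InvertsPower g L d := (Finset.mem_filter.mp (hDW hd)).2
      by_cases hdc : d = c⁻¹
      · exact Or.inl hdc
      right
      rintro (rfl | h | ⟨hcI, rfl | rfl⟩)
      · exact hc hd
      · exact hdc h
      · exact hcI.mul_self hg hdI
      · rw [← mul_inv_rev] at hdI
        exact hcI.mul_self hg hdI.of_inv
  have second : ∀ D : Finset G, W₁ ⊆ W₁ ∪ D → D ⊆ W → (∀ d ∈ D, d ∉ W₁) →
      ∃ T : Finset G, Separates S T (W₁ ∪ D) := by
    intro D
    induction D using Finset.induction_on with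
    | empty => intro _ _ _; rw [Finset.union_empty]; exact first W₁ subset_rfl
    | insert c D hc ih =>
      intro _ hD hDW₁
      obtain ⟨hcW, hDW⟩ := Finset.insert_subset_iff.mp hD
      obtain ⟨T, hT⟩ := ih Finset.subset_union_left hDW fun d hd => hDW₁ d (by simp [hd])
      have hcW₁ := hDW₁ c (by simp)
      have hcI : ¬ InvertsPower g L c := fun h => hcW₁ (Finset.mem_filter.mpr ⟨hcW, h⟩)
      have hsub : W₁ ∪ D ⊆ W := Finset.union_subset hW₁W hDW
      have hcn : c ∉ W₁ ∪ D := by simp [hcW₁, hc]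
      rw [Finset.union_insert]
      refine hT.exists_insert hL hg hS (hsub.trans hW) (hW hcW) hcn
        (hnD _ c hcn (Finset.insert_subset hcW hsub)) ?_
      intro d hd
      by_cases hdc : d = c⁻¹
      · exact Or.inl hdc
      right
      rintro (rfl | h | ⟨h, -⟩)
      · exact hcn hd
      · exact hdc h
      · exact hcI h
  obtain ⟨T, hT⟩ := second (W \ W₁) Finset.subset_union_left Finset.sdiff_subset
    fun d hd => (Finset.mem_sdiff.mp hd).2
  rw [Finset.union_sdiff_of_subset hW₁W] at hT
  exact ⟨T, hT⟩

end Greedy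

/-! ### From triangle counts to regular representations -/

section CayleyGraph

variable {G : Type*} [Group G]

theorem mulCayley_adj_iff_mem {T : Finset G} (hT : IsCayleySet (T : Set G))
    (hinv : ∀ t ∈ T, t⁻¹ ∈ T) (x y : G) :
    (SimpleGraph.mulCayley (T : Set G)).Adj x y ↔ x⁻¹ * y ∈ T := by
  rw [mulCayley_adj_iff_of_isCayleySet hT]
  refine ⟨?_, fun h => Or.inl h⟩
  rintro (h | h)
  · exact h
  · simpa using hinv _ h

theorem hasValency_card {T : Finset G} (hT : IsCayleySet (T : Set G))
    (hinv : ∀ t ∈ T, t⁻¹ ∈ T) : HasValency (SimpleGraph.mulCayley (T : Set G)) T.card := by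
  intro v
  have : (SimpleGraph.mulCayley (T : Set G)).neighborSet v = (fun t => v * t) '' (T : Set G) := by
    ext y
    rw [SimpleGraph.mem_neighborSet, mulCayley_adj_iff_mem hT hinv]
    constructor
    · exact fun h => ⟨_, h, by simp⟩
    · rintro ⟨t, ht, rfl⟩
      simpa using ht
  rw [this, (mul_right_injective v).encard_image, Set.encard_coe_eq_coe_finsetCard]

theorem HasValency.graphLocallyFinite {V : Type*} {Γ : SimpleGraph V} {d : ℕ}
    (h : HasValency Γ d) : GraphLocallyFinite Γ := fun v =>
  Set.finite_of_encard_eq_coe (h v)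

open Classical in
/-- Automorphisms of the Cayley graph of `T` preserve the number of triangles containing an
edge. -/
theorem triangleCount_map {T : Finset G} (hT : IsCayleySet (T : Set G))
    (hinv : ∀ t ∈ T, t⁻¹ ∈ T) {φ : Equiv.Perm G}
    (hφ : ∀ x y : G, (SimpleGraph.mulCayley (T : Set G)).Adj (φ x) (φ y) ↔
      (SimpleGraph.mulCayley (T : Set G)).Adj x y) (x y : G) :
    triangleCount T ((φ x)⁻¹ * φ y) = triangleCount T (x⁻¹ * y) := by
  simp only [mulCayley_adj_iff_mem hT hinv] at hφ
  symm
  refine Finset.card_bij' (fun z _ => (φ x)⁻¹ * φ (x * z)) (fun z _ => x⁻¹ * φ.symm (φ x * z))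
    ?_ ?_ ?_ ?_
  · intro z hz
    obtain ⟨h1, h2⟩ := Finset.mem_filter.mp hz
    refine Finset.mem_filter.mpr ⟨(hφ _ _).mpr (by simpa using h1), ?_⟩
    have h3 : ((φ x)⁻¹ * φ (x * z))⁻¹ * ((φ x)⁻¹ * φ y) = (φ (x * z))⁻¹ * φ y := by group
    rw [h3, hφ]
    simpa [mul_assoc] using h2
  · intro z hz
    obtain ⟨h1, h2⟩ := Finset.mem_filter.mp hz
    refine Finset.mem_filter.mpr ⟨(hφ _ _).mp (by simpa using h1), ?_⟩
    have h3 : (x⁻¹ * φ.symm (φ x * z))⁻¹ * (x⁻¹ * y) = (φ.symm (φ x * z))⁻¹ * y := by group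
    rw [h3, ← hφ]
    simpa [mul_assoc] using h2
  · intro z _; simp
  · intro z _; simp

open Classical in
/-- If the colours in `W` determine the orientation of the edges of a generating set and `G` has an
element of large order, then `G` has a graphical regular representation of controlled valency. -/
theorem exists_isGRR {S W : Finset G} (hS : IsCayleySet (S : Set G)) (hSW : S ⊆ W)
    (hW : ∀ φ : G → G, (∀ w ∈ W, PreservesColour φ w) → ∀ s ∈ S, PreservesEdges φ s)
    {m n L : ℕ} (hm : W.card ≤ m) (hn : 2 * m ^ 2 + 28 * m ≤ n)
    (hL : L = 2 * n ^ 2 + 7 * n + 1) {g : G}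
    (hg : ∀ k : ℕ, 0 < k → k ≤ 2 * L ^ 2 → g ^ k ≠ 1) :
    ∃ T : Finset G, S ⊆ T ∧ (∀ t ∈ T, t⁻¹ ∈ T) ∧ IsGRR (T : Set G) ∧
      T.card ≤ 2 * m ^ 2 + 28 * m := by
  -- The colour `1` is preserved by every map and gives no edge. Symmetrizing the rest costs `2 *
  -- m`, and separating it `2 * m ^ 2 + 26 * m`.
  set V := W.erase 1 with hV
  have hVcard : V.card ≤ m := (Finset.card_le_card (Finset.erase_subset _ _)).trans hm
  set U := V ∪ V.image (·⁻¹) with hU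
  have hUcard : U.card ≤ 2 * V.card := by
    have h1 := Finset.card_union_le V (V.image (·⁻¹))
    have h2 := Finset.card_image_le (s := V) (f := (·⁻¹))
    rw [← hU] at h1
    omega
  have hVU : V ⊆ U := Finset.subset_union_left
  have memU : ∀ x, x ∈ U ↔ x ∈ V ∨ x⁻¹ ∈ V := by
    intro x
    simp only [hU, Finset.mem_union, Finset.mem_image]
    refine or_congr_right ⟨?_, fun h => ⟨_, h, inv_inv x⟩⟩
    rintro ⟨y, hy, rfl⟩
    rwa [inv_inv]
  have hU1 : (1 : G) ∉ U := by simp [memU, hV]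
  have hUinv : ∀ x ∈ U, x⁻¹ ∈ U := by
    intro x hx
    rw [memU] at hx ⊢
    rw [inv_inv]
    exact hx.symm
  have hV2 := Nat.pow_le_pow_left hVcard 2
  obtain ⟨T, hT⟩ := exists_separates hL hg hUinv hU1 hVU (by omega)
  have hST : S ⊆ T := fun s hs => hT.extension.subset (hVU
    (Finset.mem_erase.mpr ⟨fun h => hS.2 (by rw [← h]; exact hs), hSW hs⟩))
  have hinv := hT.extension.inv_mem
  have hTC : IsCayleySet (T : Set G) := by
    refine ⟨top_le_iff.mp ?_, hT.extension.one_notMem⟩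
    rw [← hS.1]
    exact Subgroup.closure_mono (by exact_mod_cast hST)
  refine ⟨T, hST, hinv, ⟨hTC, fun φ => ⟨fun hφ => ?_, ?_⟩⟩, ?_⟩
  · have hcol : ∀ w ∈ W, PreservesColour φ w := by
      intro w hw x
      by_cases hw1 : w = 1
      · subst hw1; left; simp
      have hwV : w ∈ V := Finset.mem_erase.mpr ⟨hw1, hw⟩
      set t := (φ x)⁻¹ * φ (x * w) with ht
      have htT : t ∈ T := by
        have := (hφ x (x * w)).mpr ((mulCayley_adj_iff_mem hTC hinv _ _).mpr
          (by simpa using hT.extension.subset (hVU hwV)))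
        exact (mulCayley_adj_iff_mem hTC hinv _ _).mp this
      have hcount : triangleCount T t = triangleCount T w := by
        rw [ht, triangleCount_map hTC hinv hφ, inv_mul_cancel_left]
      have hw6 := hT.lt_count w hwV
      -- Added elements lie in at most six triangles, `w` in more.
      have htU : t ∈ U := by
        by_contra h
        have := hT.extension.count_le t htT h
        omega
      have key : t = w ∨ t = w⁻¹ := by
        rcases (memU t).mp htU with h | h
        · exact hT.eq_or_eq_inv t h w hwV hcount
        · rw [← triangleCount_inv hinv t] at hcount
          rcases hT.eq_or_eq_inv _ h w hwV hcount with h | h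
          · right; rw [← h, inv_inv]
          · left; exact inv_injective h
      have he : φ (x * w) = φ x * t := (mul_inv_cancel_left _ _).symm
      exact key.imp (fun h => he.trans (congrArg _ h)) fun h => he.trans (congrArg _ h)
    refine ⟨φ 1, ?_⟩
    ext x
    exact eq_mulLeft_of_preservesEdges hS.1 (hW φ hcol) x
  · rintro ⟨a, rfl⟩ x y
    simp [mulCayley_adj_iff_mem hTC hinv, mul_assoc]
  · have := hT.card_le
    omega

end CayleyGraph

/-! ### Numerical bounds and conclusion -/

section Main

variable {G : Type*} [Group G]

theorem OrderAtLeast.pow_ne_one {g : G} {N : ℤ} (h : OrderAtLeast g N) {k : ℕ} (hk : 0 < k)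
    (hkN : (k : ℤ) < N) : g ^ k ≠ 1 := by
  intro hgk
  rcases h with h | h
  · exact h (isOfFinOrder_iff_pow_eq_one.mpr ⟨k, hk, hgk⟩)
  · have := orderOf_le_of_pow_eq_one hk hgk
    omega

theorem lt_orderBound {n N : ℤ} (hn : 0 ≤ n) (hN : 12 ≤ N) (hnN : n ≤ N + 4) :
    2 * (2 * n ^ 2 + 7 * n + 1) ^ 2 < orderBound N := by
  unfold orderBound
  have h1 : 2 * n ^ 2 + 7 * n + 1 ≤ 2 * (2 * N ^ 2 + 3 * N - 2) := by nlinarith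
  have h2 : (2 * n ^ 2 + 7 * n + 1) ^ 2 ≤ (2 * (2 * N ^ 2 + 3 * N - 2)) ^ 2 :=
    pow_le_pow_left₀ (by positivity) h1 2
  have h3 : 0 < (2 * N ^ 2 + 3 * N - 2) ^ 2 := by
    apply pow_pos; nlinarith
  have h4 : 4 < 2 * N ^ 2 + 4 * N - 1 := by nlinarith
  nlinarith [mul_lt_mul_of_pos_left h4 h3]

theorem orderBound_le {N : ℤ} (hN : 4 ≤ N) : orderBound N ≤ 64 * N ^ 6 := by
  unfold orderBound
  have h1 : (2 * N ^ 2 + 3 * N - 2) ^ 2 ≤ (3 * N ^ 2) ^ 2 :=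
    pow_le_pow_left₀ (by nlinarith) (by nlinarith) 2
  have h2 : 2 * N ^ 2 + 4 * N - 1 ≤ 3 * N ^ 2 := by nlinarith
  calc 2 * (2 * N ^ 2 + 3 * N - 2) ^ 2 * (2 * N ^ 2 + 4 * N - 1)
      ≤ 2 * (3 * N ^ 2) ^ 2 * (3 * N ^ 2) := by
        apply mul_le_mul (by linarith) h2 (by nlinarith) (by positivity)
    _ = 54 * N ^ 6 := by ring
    _ ≤ 64 * N ^ 6 := by
        have : 0 ≤ N ^ 6 := by positivity
        linarith

theorem exists_isGRR_of_orderAtLeast {S W : Finset G} (hS : IsCayleySet (S : Set G)) (hSW : S ⊆ W)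
    (hW : ∀ φ : G → G, (∀ w ∈ W, PreservesColour φ w) → ∀ s ∈ S, PreservesEdges φ s)
    {m : ℕ} (hm : W.card ≤ m) {N : ℤ} (hN : 12 ≤ N) (hmN : 2 * (m : ℤ) ^ 2 + 28 * m ≤ N + 4)
    {g : G} (hg : OrderAtLeast g (orderBound N)) :
    ∃ T : Finset G, S ⊆ T ∧ (∀ t ∈ T, t⁻¹ ∈ T) ∧ IsGRR (T : Set G) ∧
      T.card ≤ 2 * m ^ 2 + 28 * m := by
  refine exists_isGRR hS hSW hW hm le_rfl rfl fun k hk hkL => hg.pow_ne_one hk ?_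
  have h1 := lt_orderBound (n := 2 * (m : ℤ) ^ 2 + 28 * m) (by positivity) hN hmN
  refine lt_of_le_of_lt ?_ h1
  exact_mod_cast hkL

theorem exists_isGRR_card_le (hab : ¬ ∀ a b : G, a * b = b * a) (hdic : ¬ IsGeneralizedDicyclic G)
    {S : Finset G} (hS : IsCayleySet (S : Set G)) {g : G}
    (hg : OrderAtLeast g (orderBound (32 * (S.card : ℤ) ^ 6))) :
    ∃ T : Finset G, S ⊆ T ∧ (∀ t ∈ T, t⁻¹ ∈ T) ∧ IsGRR (T : Set G) ∧
      T.card ≤ 32 * S.card ^ 6 := by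
  have hr := two_le_card hab hS.1
  obtain ⟨W, hSW, hWcard, hW⟩ := exists_colours_of_forced fun s (_ : s ∈ S) =>
    forced_seven hab hdic s
  have h4 : 2 ^ 4 ≤ S.card ^ 4 := Nat.pow_le_pow_left hr 4
  -- Seven colours for each element of `S` give `m = 7 * S.card`; degree six absorbs the constants
  -- because `S.card ≥ 2`.
  have hle : 2 * (7 * S.card) ^ 2 + 28 * (7 * S.card) ≤ 32 * S.card ^ 6 := by
    calc 2 * (7 * S.card) ^ 2 + 28 * (7 * S.card) ≤ 32 * (2 ^ 4 * S.card ^ 2) := by nlinarith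
      _ ≤ 32 * (S.card ^ 4 * S.card ^ 2) := by gcongr
      _ = 32 * S.card ^ 6 := by ring
  have h12 : 12 ≤ 32 * S.card ^ 6 := by nlinarith
  obtain ⟨T, h1, h2, h3, h5⟩ := exists_isGRR_of_orderAtLeast hS hSW hW hWcard
    (N := 32 * (S.card : ℤ) ^ 6) (by exact_mod_cast h12)
    (by
      have : ((2 * (7 * S.card) ^ 2 + 28 * (7 * S.card) : ℕ) : ℤ) ≤ (32 * S.card ^ 6 : ℕ) := by
        exact_mod_cast hle
      push_cast at this ⊢
      linarith) hg
  exact ⟨T, h1, h2, h3, h5.trans hle⟩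

theorem exists_isGRR_card_le_of_noOrderFourOrNoCharAbelian (hab : ¬ ∀ a b : G, a * b = b * a)
    (h : NoOrderFourOrNoCharAbelian G) {S : Finset G} (hS : IsCayleySet (S : Set G)) {g : G}
    (hg : OrderAtLeast g (orderBound (18 * (S.card : ℤ) ^ 2 + 84 * (S.card : ℤ) - 4))) :
    ∃ T : Finset G, S ⊆ T ∧ (∀ t ∈ T, t⁻¹ ∈ T) ∧ IsGRR (T : Set G) ∧
      T.card ≤ 18 * S.card ^ 2 + 84 * S.card := by
  have hr : (2 : ℤ) ≤ S.card := by exact_mod_cast two_le_card hab hS.1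
  obtain ⟨W, hSW, hWcard, hW⟩ := exists_colours_of_noOrderFourOrNoCharAbelian hab hS.1 h
  obtain ⟨T, h1, h2, h3, h5⟩ := exists_isGRR_of_orderAtLeast hS hSW hW hWcard
    (by nlinarith) (by push_cast; linarith) hg
  exact ⟨T, h1, h2, h3, h5.trans (le_of_eq (by ring))⟩

open Classical in
theorem exists_isCayleySet_card_eq_rank (G : Type*) [Group G] [Group.FG G] :
    ∃ S : Finset G, IsCayleySet (S : Set G) ∧ S.card = Group.rank G := by
  obtain ⟨S, hcard, hS⟩ := Group.rank_spec G
  have h1 : Subgroup.closure ((S.erase 1 : Finset G) : Set G) = ⊤ := by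
    rw [Finset.coe_erase, Subgroup.closure_sdiff_one, hS]
  refine ⟨S.erase 1, ⟨h1, by simp⟩, le_antisymm ?_ (Group.rank_le h1)⟩
  rw [← hcard]
  exact Finset.card_le_card (Finset.erase_subset _ _)

end Main

theorem theorem1 {G : Type*} [Group G] [Group.FG G]
    (hab : ¬ ∀ a b : G, a * b = b * a) (hdic : ¬ IsGeneralizedDicyclic G) :
    -- an element of order at least `(2 rank G)^36` gives a locally finite GRR
    ((∃ g : G, OrderAtLeast g ((2 * (Group.rank G : ℤ)) ^ 36)) →
      ∃ S : Set G, IsGRR S ∧ GraphLocallyFinite (SimpleGraph.mulCayley S)) ∧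
    -- GRR of bounded valency
    ((∃ g : G, OrderAtLeast g (orderBound (32 * (Group.rank G : ℤ) ^ 6))) →
      ∃ S : Set G, IsGRR S ∧
        ∃ d : ℕ, HasValency (SimpleGraph.mulCayley S) d ∧ d ≤ 32 * Group.rank G ^ 6) ∧
    -- the better bound
    (NoOrderFourOrNoCharAbelian G →
      (∃ g : G, OrderAtLeast g
        (orderBound (18 * (Group.rank G : ℤ) ^ 2 + 84 * (Group.rank G : ℤ) - 4))) →
      ∃ S : Set G, IsGRR S ∧
        ∃ d : ℕ, HasValency (SimpleGraph.mulCayley S) d ∧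
          d ≤ 18 * Group.rank G ^ 2 + 84 * Group.rank G) ∧
    -- enlarging a given finite generating set to a GRR
    ((∀ n : ℕ, ∃ g : G, OrderAtLeast g n) →
      ∀ S : Finset G, IsCayleySet (S : Set G) →
        (∃ T : Finset G, S ⊆ T ∧ (∀ t ∈ T, t⁻¹ ∈ T) ∧ IsGRR (T : Set G) ∧
          T.card ≤ 32 * S.card ^ 6) ∧
        (NoOrderFourOrNoCharAbelian G →
          ∃ T : Finset G, S ⊆ T ∧ (∀ t ∈ T, t⁻¹ ∈ T) ∧ IsGRR (T : Set G) ∧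
            T.card ≤ 18 * S.card ^ 2 + 84 * S.card)) := by
  have finite_of : (∃ g : G, OrderAtLeast g (orderBound (32 * (Group.rank G : ℤ) ^ 6))) →
      ∃ S : Set G, IsGRR S ∧
        ∃ d : ℕ, HasValency (SimpleGraph.mulCayley S) d ∧ d ≤ 32 * Group.rank G ^ 6 := by
    rintro ⟨g, hg⟩
    obtain ⟨S, hS, hcard⟩ := exists_isCayleySet_card_eq_rank G
    rw [← hcard] at hg ⊢
    obtain ⟨T, -, hinv, hT, hTcard⟩ := exists_isGRR_card_le hab hdic hS hg
    exact ⟨T, hT, T.card, hasValency_card hT.1 hinv, hTcard⟩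
  refine ⟨?_, finite_of, ?_, ?_⟩
  · rintro ⟨g, hg⟩
    obtain ⟨S, hS, hcard⟩ := exists_isCayleySet_card_eq_rank G
    have hr : 2 ≤ Group.rank G := hcard ▸ two_le_card hab hS.1
    have h64 : (2 : ℤ) ^ 6 ≤ (Group.rank G : ℤ) ^ 6 :=
      pow_le_pow_left₀ (by norm_num) (by exact_mod_cast hr) 6
    -- With `N = 32 * r ^ 6`, the bound `64 * N ^ 6` is exactly `(2 * r) ^ 36`.
    have hle : orderBound (32 * (Group.rank G : ℤ) ^ 6) ≤ (2 * (Group.rank G : ℤ)) ^ 36 :=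
      (orderBound_le (by linarith)).trans (le_of_eq (by ring))
    obtain ⟨S, hS, d, hd, -⟩ := finite_of ⟨g, hg.imp_right hle.trans⟩
    exact ⟨S, hS, hd.graphLocallyFinite⟩
  · rintro h ⟨g, hg⟩
    obtain ⟨S, hS, hcard⟩ := exists_isCayleySet_card_eq_rank G
    rw [← hcard] at hg ⊢
    obtain ⟨T, -, hinv, hT, hTcard⟩ :=
      exists_isGRR_card_le_of_noOrderFourOrNoCharAbelian hab h hS hg
    exact ⟨T, hT, T.card, hasValency_card hT.1 hinv, hTcard⟩
  · intro hlarge S hS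
    have large : ∀ N : ℤ, ∃ g : G, OrderAtLeast g N := fun N => by
      obtain ⟨g, hg⟩ := hlarge N.toNat
      exact ⟨g, hg.imp_right N.self_le_toNat.trans⟩
    refine ⟨?_, fun h => ?_⟩
    · obtain ⟨g, hg⟩ := large _
      exact exists_isGRR_card_le hab hdic hS hg
    · obtain ⟨g, hg⟩ := large _
      exact exists_isGRR_card_le_of_noOrderFourOrNoCharAbelian hab h hS hg
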